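/- For $n \ge 1$, a partition of degree $n$ is an equivalence relation on the $2n$-element set $\{1,\ldots,n\}\cup\{1',\ldots,n'\}$; its classes are called blocks, and a block is transverse if it contains points of both $\{1,\ldots,n\}$ and $\{1',\ldots,n'\}$. The partition monoid $\mathcal{P}_n$ is the set of all partitions of degree $n$ with the following product. Given $\alpha,\beta$, replace each $i'$ by $i''$ in $\alpha$ and each $i$ by $i''$ in $\beta$, take the smallest equivalence on $\{1,\ldots,n\}\cup\{1'',\ldots,n''\}\cup\{1',\ldots,n'\}$ containing both resulting relations, and let $\alpha\beta$ be its restriction to $\{1,\ldots,n\}\cup\{1',\ldots,n'\}$. The identity has the blocks $\{i,i'\}$. Let $\mathcal{S}_n\subseteq\mathcal{P}_n$ be the copy of the symmetric group of degree $n$ obtained by identifying a permutation $\sigma$ with the partition whose blocks are $\{i,(i\sigma)'\}$, $1\le i\le n$. For $\alpha\in\mathcal{P}_n$ let $\operatorname{rank}(\alpha)$ be the number of transverse blocks of $\alpha$, let $\ker(\alpha)$ be the restriction of $\alpha$ to $\{1,\ldots,n\}$ (trivial if it is the equality relation), and let $\operatorname{dom}(\alpha)$ be the set of points of $\{1,\ldots,n\}$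 that lie in transverse blocks. Put $\operatorname{coker}(\alpha)=\ker(\alpha^*)$ and $\operatorname{codom}(\alpha)=\operatorname{dom}(\alpha^*)$, where $\alpha^*$ is obtained from $\alpha$ by exchanging $i$ and $i'$ for every $i$. A subsemigroup is maximal if it is proper and is contained in no other proper subsemigroup. **Theorem.** Let $n\ge 2$. The maximal subsemigroups of $\mathcal{P}_n$ are exactly the following sets: (a) $(\mathcal{P}_n\setminus\mathcal{S}_n)\cup U$, where $U$ is a maximal subgroup of $\mathcal{S}_n$; (b) $\mathcal{P}_n\setminus\{\alpha\in\mathcal{P}_n : \operatorname{rank}(\alpha)=n-1 \text{ and } \ker(\alpha) \text{ is trivial}\}$; (c) $\mathcal{P}_n\setminus\{\alpha\in\mathcal{P}_n : \operatorname{rank}(\alpha)=n-1 \text{ and } \operatorname{dom}(\alpha)=\{1,\ldots,n\}\}$; (d) $\mathcal{P}_n\setminus\{\alpha\in\mathcal{P}_n : \operatorname{rank}(\alpha)=n-1 \text{ and } \operatorname{coker}(\alpha) \text{ is trivial}\}$; (e) $\mathcal{P}_n\setminus\{\alpha\in\mathcal{P}_n : \operatorname{rank}(\alpha)=n-1 \text{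 and } \operatorname{codom}(\alpha)=\{1,\ldots,n\}\}$. In particular, for $n\ge 2$ there are $s_n+4$ maximal subsemigroups of $\mathcal{P}_n$, where $s_n$ is the number of maximal subgroups of the symmetric group of degree $n$. The partition monoid $\mathcal{P}_1$ of degree $1$ is a semilattice of order $2$ (that is, it is commutative, all its elements are idempotent, and it has exactly two elements), and its maximal subsemigroups are exactly its singleton subsets. -/

import Mathlib

/-- A partition of degree `n`: an equivalence relation on `{1, …, n} ∪ {1', …, n'}`, where
`Sum.inl i` is the point `i` and `Sum.inr i` is the point `i'`. -/
def PartitionMonoid (n : ℕ) : Type := Setoid (Fin n ⊕ Fin n)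

namespace PartitionMonoid

variable {n : ℕ}

/-- The underlying equivalence relation. -/
def toSetoid (α : PartitionMonoid n) : Setoid (Fin n ⊕ Fin n) := α

/-- The relation `α' ∪ β'` on `{1, …, n} ∪ {1'', …, n''} ∪ {1', …, n'}` (in this order in the
threefold sum): `α'` is `α` with each `i'` replaced by `i''`, and `β'` is `β` with each `i`
replaced by `i''`. -/
def stack (α β : PartitionMonoid n) (x y : Fin n ⊕ (Fin n ⊕ Fin n)) : Prop :=
  Relation.Map α.toSetoid (Sum.map id Sum.inl) (Sum.map id Sum.inl) x y ∨
    Relation.Map β.toSetoid Sum.inr Sum.inr x y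

/-- The product: generate an equivalence from `α' ∪ β'` and restrict it to the points
`1, …, n, 1', …, n'`. -/
instance : Mul (PartitionMonoid n) where
  mul α β := Setoid.comap (Sum.map id Sum.inr) (Relation.EqvGen.setoid (stack α β))

/-- The identity: the partition with blocks `{i, i'}`. -/
instance : One (PartitionMonoid n) where
  one := Setoid.ker (Sum.elim id id)

theorem ext_toSetoid {α β : PartitionMonoid n}
    (h : ∀ x y, α.toSetoid x y ↔ β.toSetoid x y) : α = β :=
  Setoid.ext h

theorem mul_rel (α β : PartitionMonoid n) (x y : Fin n ⊕ Fin n) :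
    (α * β).toSetoid x y ↔
      Relation.EqvGen (stack α β) (Sum.map id Sum.inr x) (Sum.map id Sum.inr y) :=
  Iff.rfl

theorem one_rel (x y : Fin n ⊕ Fin n) :
    (1 : PartitionMonoid n).toSetoid x y ↔ Sum.elim id id x = Sum.elim id id y :=
  Iff.rfl

/-- The subset `P ∪ Q'` of `{1, …, n} ∪ {1', …, n'}` is a union of blocks of `α`. -/
def Saturated (α : PartitionMonoid n) (P Q : Fin n → Prop) : Prop :=
  ∀ x y, α.toSetoid x y → (Sum.elim P Q x ↔ Sum.elim P Q y)

theorem ext_saturated {α β : PartitionMonoid n}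
    (h : ∀ P Q, α.Saturated P Q ↔ β.Saturated P Q) : α = β := by
  have key : ∀ {α β : PartitionMonoid n}, (∀ P Q, α.Saturated P Q → β.Saturated P Q) →
      ∀ x y, β.toSetoid x y → α.toSetoid x y := by
    intro α β h x y hxy
    have hs : Sum.elim (fun i => α.toSetoid x (Sum.inl i)) (fun i => α.toSetoid x (Sum.inr i))
        = fun z => α.toSetoid x z := by
      funext z; cases z <;> rfl
    have h2 := h (fun i => α.toSetoid x (Sum.inl i)) (fun i => α.toSetoid x (Sum.inr i)) (by
      intro u v huv
      rw [hs]
      exact ⟨fun k => α.toSetoid.trans' k huv,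
        fun k => α.toSetoid.trans' k (α.toSetoid.symm' huv)⟩) x y hxy
    rw [hs] at h2
    exact h2.1 (α.toSetoid.refl' x)
  exact ext_toSetoid fun x y =>
    ⟨key (fun P Q => (h P Q).2) x y, key (fun P Q => (h P Q).1) x y⟩

theorem saturated_one (P Q : Fin n → Prop) :
    (1 : PartitionMonoid n).Saturated P Q ↔ P = Q := by
  constructor
  · intro h
    funext i
    exact propext (h (Sum.inl i) (Sum.inr i) rfl)
  · rintro rfl x y hxy
    rw [one_rel] at hxy
    cases x <;> cases y <;> simp_all

theorem saturated_mul (α β : PartitionMonoid n) (P R : Fin n → Prop) :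
    (α * β).Saturated P R ↔ ∃ Q, α.Saturated P Q ∧ β.Saturated Q R := by
  constructor
  · intro h
    let F : Fin n ⊕ (Fin n ⊕ Fin n) → Prop := fun z =>
      ∃ x : Fin n ⊕ Fin n, Sum.elim P R x ∧ Relation.EqvGen (stack α β) (Sum.map id Sum.inr x) z
    have hF : ∀ x, F (Sum.map id Sum.inr x) ↔ Sum.elim P R x := fun x =>
      ⟨fun ⟨y, hy, hyx⟩ => (h y x hyx).1 hy, fun hx => ⟨x, hx, Relation.EqvGen.refl _⟩⟩
    have hresp : ∀ u v, stack α β u v → (F u ↔ F v) := fun u v huv =>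
      ⟨fun ⟨x, hx, hxu⟩ => ⟨x, hx, hxu.trans _ _ _ (.rel _ _ huv)⟩,
        fun ⟨x, hx, hxu⟩ => ⟨x, hx, hxu.trans _ _ _ (.symm _ _ (.rel _ _ huv))⟩⟩
    have hP : ∀ i, F (Sum.inl i) ↔ P i := fun i => hF (Sum.inl i)
    have hR : ∀ i, F (Sum.inr (Sum.inr i)) ↔ R i := fun i => hF (Sum.inr i)
    refine ⟨fun i => F (Sum.inr (Sum.inl i)), ?_, ?_⟩
    · intro x y hxy
      have := hresp _ _ (Or.inl ⟨x, y, hxy, rfl, rfl⟩)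
      cases x <;> cases y <;> simpa [hP] using this
    · intro x y hxy
      have := hresp _ _ (Or.inr ⟨x, y, hxy, rfl, rfl⟩)
      cases x <;> cases y <;> simpa [hR] using this
  · rintro ⟨Q, h1, h2⟩ x y hxy
    have key : ∀ u v, Relation.EqvGen (stack α β) u v →
        (Sum.elim P (Sum.elim Q R) u ↔ Sum.elim P (Sum.elim Q R) v) := by
      intro u v huv
      induction huv with
      | rel u v h =>
        rcases h with ⟨a, b, hab, rfl, rfl⟩ | ⟨a, b, hab, rfl, rfl⟩
        · have := h1 a b hab
          cases a <;> cases b <;> simpa using this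
        · exact h2 a b hab
      | refl => exact Iff.rfl
      | symm _ _ _ ih => exact ih.symm
      | trans _ _ _ _ _ ih1 ih2 => exact ih1.trans ih2
    have := key _ _ hxy
    cases x <;> cases y <;> simpa using this

instance : Monoid (PartitionMonoid n) where
  mul_assoc α β γ := ext_saturated fun P Q => by
    simp only [saturated_mul]
    constructor
    · rintro ⟨B, ⟨A, h1, h2⟩, h3⟩
      exact ⟨A, h1, B, h2, h3⟩
    · rintro ⟨A, h1, B, h2, h3⟩
      exact ⟨B, ⟨A, h1, h2⟩, h3⟩
  one_mul α := ext_saturated fun P Q => by simp [saturated_mul, saturated_one]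
  mul_one α := ext_saturated fun P Q => by simp [saturated_mul, saturated_one]

/-- The partition `α*` obtained by exchanging `i` and `i'` for all `i`. -/
def star (α : PartitionMonoid n) : PartitionMonoid n := Setoid.comap Sum.swap α.toSetoid

/-- The blocks of `α` are its equivalence classes. -/
def blocks (α : PartitionMonoid n) : Set (Set (Fin n ⊕ Fin n)) := α.toSetoid.classes

/-- A block is transverse if it contains points of both `{1, …, n}` and `{1', …, n'}`. -/
def IsTransverse (B : Set (Fin n ⊕ Fin n)) : Prop :=
  (∃ i, Sum.inl i ∈ B) ∧ ∃ j, Sum.inr j ∈ B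

/-- The rank: the number of transverse blocks. -/
noncomputable def rank (α : PartitionMonoid n) : ℕ :=
  Set.ncard {B | B ∈ α.blocks ∧ IsTransverse B}

/-- The kernel: the restriction of `α` to `{1, …, n}`. -/
def ker (α : PartitionMonoid n) : Setoid (Fin n) := Setoid.comap Sum.inl α.toSetoid

/-- The domain: the points of `{1, …, n}` that lie in a transverse block. -/
def dom (α : PartitionMonoid n) : Set (Fin n) :=
  {i | ∃ B ∈ α.blocks, IsTransverse B ∧ Sum.inl i ∈ B}

/-- The cokernel. -/
def coker (α : PartitionMonoid n) : Setoid (Fin n) := α.star.ker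

/-- The codomain. -/
def codom (α : PartitionMonoid n) : Set (Fin n) := α.star.dom

/-- The canonical embedding of the symmetric group: `σ` is sent to the partition with blocks
`{i, (σ i)'}`. Permutations are composed from right to left by `*` on `Equiv.Perm`, and from left
to right in the partition monoid, so this map reverses products; images of subgroups are not
affected. -/
def ofPerm (σ : Equiv.Perm (Fin n)) : PartitionMonoid n := Setoid.ker (Sum.elim σ id)

/-- The copy of the symmetric group of degree `n` in the partition monoid of degree `n`. -/
def symmetricGroup (n : ℕ) : Set (PartitionMonoid n) := Set.range ofPerm

end PartitionMonoid

/-- The set `X` is a maximal subsemigroup of `S`: a proper subsemigroup contained in no other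
proper subsemigroup. -/
def IsMaximalSubsemigroup {S : Type*} [Mul S] (X : Set S) : Prop :=
  ∃ M : Subsemigroup S, (M : Set S) = X ∧ IsCoatom M

/-! A partition is determined by its saturated pairs `(P, Q)`, and in these terms the product is
composition of relations (`saturated_mul`). Identities between partitions thus become arguments
about predicates.

By `isMaximalSubsemigroup_iff_mem` it suffices that the listed sets are proper subsemigroups, that
none lies in another, and that every proper subsemigroup `M` lies in one of them. Closure under
products comes from rank, which products cannot increase. A product is a unit only if both factors
are. If a product has rank `n - 1`, its left factor is either a unit, which can be cancelled, or
itself of rank `n - 1`, and then it inherits a trivial kernel or full domain from the product. The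
involution handles cokernels and codomains.

For the covering, if `M` misses a permutation, then its permutations lie in a maximal subgroup.
Suppose instead that `M` contains all permutations and meets all four removed sets. A partition of
rank `n - 1` has trivial kernel or full domain, and trivial cokernel or full codomain
(`exists_normal_form`), so its type is a cell of a two-by-two grid. Since `M` meets both rows and
both columns, it occupies a diagonal (`eq_top_of_mem`). One diagonal yields some `proj {i}` and an
idempotent merging two points; the other yields two collapses whose products in the two orders are
again such idempotents (`eq_top_of_collapse_mem`). Together with the permutations these generate
everything (`eq_top_of_proj_mem_of_merge_mem`). -/

namespace PartitionMonoid

variable {n : ℕ}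

/-! ### Partitions given by labels, and their saturated pairs -/

/-- The partition in which two points are related if they have the same image, where `u` is
applied to the upper points and `v` to the lower ones. -/
def ofMaps {Y : Type*} (u v : Fin n → Y) : PartitionMonoid n := Setoid.ker (Sum.elim u v)

theorem ofMaps_rel {Y : Type*} (u v : Fin n → Y) (x y : Fin n ⊕ Fin n) :
    (ofMaps u v).toSetoid x y ↔ Sum.elim u v x = Sum.elim u v y := Iff.rfl

/-- Each point is labelled by its own block; this makes `rank_ofMaps` available for arbitrary
partitions. -/
theorem eq_ofMaps_quotient (α : PartitionMonoid n) :
    α = ofMaps (fun i => Quotient.mk α.toSetoid (Sum.inl i))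
      (fun i => Quotient.mk α.toSetoid (Sum.inr i)) := by
  apply ext_toSetoid
  intro x y
  rw [ofMaps_rel]
  have h : ∀ z : Fin n ⊕ Fin n, Sum.elim (fun i => Quotient.mk α.toSetoid (Sum.inl i))
      (fun i => Quotient.mk α.toSetoid (Sum.inr i)) z = Quotient.mk α.toSetoid z := by
    rintro (z | z) <;> rfl
  rw [h, h, Quotient.eq]

theorem saturated_ofMaps {Y : Type*} (u v : Fin n → Y) (P Q : Fin n → Prop) :
    (ofMaps u v).Saturated P Q ↔ (∀ a b, u a = u b → (P a ↔ P b)) ∧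
      (∀ a b, v a = v b → (Q a ↔ Q b)) ∧ ∀ a b, u a = v b → (P a ↔ Q b) := by
  constructor
  · intro h
    exact ⟨fun a b e => h (.inl a) (.inl b) e, fun a b e => h (.inr a) (.inr b) e,
      fun a b e => h (.inl a) (.inr b) e⟩
  · rintro ⟨h1, h2, h3⟩ (x | x) (y | y) hxy
    · exact h1 _ _ hxy
    · exact h3 _ _ hxy
    · exact (h3 _ _ (Eq.symm hxy)).symm
    · exact h2 _ _ hxy

/-- The block of `x` is itself saturated, so testing against it suffices. -/
theorem rel_iff_saturated (α : PartitionMonoid n) (x y : Fin n ⊕ Fin n) :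
    α.toSetoid x y ↔ ∀ P Q, α.Saturated P Q → (Sum.elim P Q x ↔ Sum.elim P Q y) := by
  constructor
  · intro h P Q hs
    exact hs x y h
  · intro h
    have hs : Sum.elim (fun i => α.toSetoid x (Sum.inl i)) (fun i => α.toSetoid x (Sum.inr i))
        = fun z => α.toSetoid x z := by
      funext z; cases z <;> rfl
    have h2 := h (fun i => α.toSetoid x (Sum.inl i)) (fun i => α.toSetoid x (Sum.inr i)) (by
      intro u v huv
      rw [hs]
      exact ⟨fun k => α.toSetoid.trans' k huv,
        fun k => α.toSetoid.trans' k (α.toSetoid.symm' huv)⟩)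
    rw [hs] at h2
    exact h2.1 (α.toSetoid.refl' x)

/-! ### Permutations and the involution -/

theorem saturated_ofPerm (σ : Equiv.Perm (Fin n)) (P Q : Fin n → Prop) :
    (ofPerm σ).Saturated P Q ↔ ∀ a, P a ↔ Q (σ a) := by
  change (ofMaps σ id).Saturated P Q ↔ _
  rw [saturated_ofMaps]
  constructor
  · intro h a
    exact h.2.2 a _ rfl
  · intro h
    refine ⟨?_, ?_, ?_⟩
    · intro a b e
      rw [σ.injective e]
    · rintro a b rfl
      rfl
    · rintro a b rfl
      exact h a

theorem saturated_mul_ofPerm (α : PartitionMonoid n) (σ : Equiv.Perm (Fin n))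
    (P Q : Fin n → Prop) :
    (α * ofPerm σ).Saturated P Q ↔ α.Saturated P (fun a => Q (σ a)) := by
  simp only [saturated_mul, saturated_ofPerm]
  constructor
  · rintro ⟨R, h, h'⟩
    rwa [show (fun a => Q (σ a)) = R from funext fun a => propext (h' a).symm]
  · intro h
    exact ⟨_, h, fun a => Iff.rfl⟩

theorem saturated_ofPerm_mul (α : PartitionMonoid n) (σ : Equiv.Perm (Fin n))
    (P Q : Fin n → Prop) :
    (ofPerm σ * α).Saturated P Q ↔ α.Saturated (fun a => P (σ⁻¹ a)) Q := by
  simp only [saturated_mul, saturated_ofPerm]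
  constructor
  · rintro ⟨R, h, h'⟩
    rwa [show (fun a => P (σ⁻¹ a)) = R from funext fun a => propext (by simp [h])]
  · intro h
    exact ⟨_, fun a => by simp, h⟩

theorem ofPerm_one : (ofPerm 1 : PartitionMonoid n) = 1 := rfl

theorem ofPerm_mul (σ τ : Equiv.Perm (Fin n)) : ofPerm σ * ofPerm τ = ofPerm (τ * σ) :=
  ext_saturated fun P Q => by
    rw [saturated_mul_ofPerm, saturated_ofPerm, saturated_ofPerm]; rfl

theorem ofPerm_injective : Function.Injective (ofPerm (n := n)) := by
  intro σ τ h
  ext a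
  have : (ofPerm τ).toSetoid (.inl a) (.inr (σ a)) := h ▸ (rfl : σ a = id (σ a))
  exact congrArg _ (show τ a = σ a from this).symm

theorem saturated_star (α : PartitionMonoid n) (P Q : Fin n → Prop) :
    α.star.Saturated P Q ↔ α.Saturated Q P := by
  constructor <;> intro h x y hxy
  · have := h x.swap y.swap (by
      change α.toSetoid x.swap.swap y.swap.swap
      simpa using hxy)
    cases x <;> cases y <;> exact this
  · have := h x.swap y.swap hxy
    cases x <;> cases y <;> exact this

theorem star_mul (α β : PartitionMonoid n) : (α * β).star = β.star * α.star :=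
  ext_saturated fun P Q => by
    simp only [saturated_star, saturated_mul]
    exact exists_congr fun _ => and_comm

theorem star_ofMaps {Y : Type*} (u v : Fin n → Y) : (ofMaps u v).star = ofMaps v u :=
  ext_saturated fun P Q => by
    simp only [saturated_star, saturated_ofMaps]
    exact ⟨fun ⟨a, b, c⟩ => ⟨b, a, fun i j e => (c j i e.symm).symm⟩,
      fun ⟨a, b, c⟩ => ⟨b, a, fun i j e => (c j i e.symm).symm⟩⟩

/-! ### Kernel, domain and rank -/

theorem ker_rel (α : PartitionMonoid n) (a b : Fin n) :
    α.ker a b ↔ α.toSetoid (.inl a) (.inl b) := Iff.rfl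

theorem coker_rel (α : PartitionMonoid n) (a b : Fin n) :
    α.coker a b ↔ α.toSetoid (.inr a) (.inr b) := Iff.rfl

theorem mem_dom (α : PartitionMonoid n) (a : Fin n) :
    a ∈ α.dom ↔ ∃ b, α.toSetoid (.inl a) (.inr b) := by
  constructor
  · rintro ⟨B, ⟨x, rfl⟩, ⟨-, j, hj⟩, ha⟩
    exact ⟨j, α.toSetoid.trans' ha (α.toSetoid.symm' hj)⟩
  · rintro ⟨b, hb⟩
    exact ⟨_, ⟨.inl a, rfl⟩, ⟨⟨a, α.toSetoid.refl' _⟩, b, α.toSetoid.symm' hb⟩,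
      α.toSetoid.refl' _⟩

theorem mem_codom (α : PartitionMonoid n) (a : Fin n) :
    a ∈ α.codom ↔ ∃ b, α.toSetoid (.inr a) (.inl b) :=
  mem_dom α.star a

theorem mem_dom_ofMaps {Y : Type*} (u v : Fin n → Y) (a : Fin n) :
    a ∈ (ofMaps u v).dom ↔ u a ∈ Set.range v := by
  rw [mem_dom]
  exact exists_congr fun b => eq_comm

theorem rank_ofMaps {Y : Type*} (u v : Fin n → Y) :
    (ofMaps u v).rank = (Set.range u ∩ Set.range v).ncard := by
  symm
  let f : Y → Set (Fin n ⊕ Fin n) := fun y => {x | Sum.elim u v x = y}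
  have hi : Set.InjOn f (Set.range u ∩ Set.range v) := by
    rintro _ ⟨⟨a, rfl⟩, -⟩ y - h
    have : Sum.inl a ∈ f y := h ▸ (rfl : Sum.elim u v (.inl a) = u a)
    exact this
  rw [rank, ← hi.ncard_image]
  congr 1
  ext B
  constructor
  · rintro ⟨y, ⟨⟨a, rfl⟩, ⟨b, hb⟩⟩, rfl⟩
    exact ⟨⟨.inl a, rfl⟩, ⟨a, rfl⟩, b, hb⟩
  · rintro ⟨⟨x, rfl⟩, ⟨a, ha⟩, b, hb⟩
    exact ⟨Sum.elim u v x, ⟨⟨a, ha⟩, ⟨b, hb⟩⟩, rfl⟩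

theorem rank_star (α : PartitionMonoid n) : α.star.rank = α.rank := by
  rw [eq_ofMaps_quotient α, star_ofMaps, rank_ofMaps, rank_ofMaps, Set.inter_comm]

/-- A transverse block is determined by its upper part, a kernel class inside the domain. This
one-sided count makes rank comparable between a product and its left factor. -/
theorem rank_eq_ncard_image_dom (α : PartitionMonoid n) :
    α.rank = (Quotient.mk α.ker '' α.dom).ncard := by
  let u : Fin n → Quotient α.toSetoid := fun i => Quotient.mk α.toSetoid (Sum.inl i)
  let g : Quotient α.ker → Quotient α.toSetoid := Quotient.lift u
    fun a b h => Quotient.sound h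
  have hg : Function.Injective g := by
    rintro ⟨a⟩ ⟨b⟩ h
    have h : Quotient.mk α.toSetoid (Sum.inl a) = Quotient.mk α.toSetoid (Sum.inl b) := h
    have h := Quotient.exact h
    exact Quotient.sound h
  rw [← Set.ncard_image_of_injective _ hg]
  conv_lhs => rw [eq_ofMaps_quotient α, rank_ofMaps]
  congr 1
  ext q
  constructor
  · rintro ⟨⟨a, rfl⟩, b, hb⟩
    exact ⟨_, ⟨a, (mem_dom _ _).2 ⟨b, α.toSetoid.symm' (Quotient.exact hb)⟩, rfl⟩, rfl⟩
  · rintro ⟨_, ⟨a, ha, rfl⟩, rfl⟩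
    obtain ⟨b, hb⟩ := (mem_dom _ _).1 ha
    exact ⟨⟨a, rfl⟩, b, Quotient.sound (α.toSetoid.symm' hb)⟩

theorem ker_le_ker_mul (α β : PartitionMonoid n) : α.ker ≤ (α * β).ker := by
  intro a b h
  change (α * β).toSetoid _ _
  rw [rel_iff_saturated]
  intro P Q hs
  obtain ⟨R, hR, -⟩ := (saturated_mul _ _ _ _).1 hs
  exact hR (.inl a) (.inl b) h

theorem dom_mul_subset (α β : PartitionMonoid n) : (α * β).dom ⊆ α.dom := by
  intro a h
  obtain ⟨b, hb⟩ := (mem_dom _ _).1 h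
  by_contra ha
  -- If the block of `a` in `α` has no lower points, it is already saturated in the product, with
  -- nothing below.
  have hs : (α * β).Saturated (fun i => α.toSetoid (.inl a) (.inl i)) (fun _ => False) := by
    refine (saturated_mul _ _ _ _).2 ⟨fun _ => False, ?_, ?_⟩
    · have hn : ∀ j, ¬ α.toSetoid (.inl a) (.inr j) := fun j hj => ha ((mem_dom _ _).2 ⟨j, hj⟩)
      rintro (x | x) (y | y) hxy
      · exact ⟨fun k => α.toSetoid.trans' k hxy,
          fun k => α.toSetoid.trans' k (α.toSetoid.symm' hxy)⟩
      · exact iff_of_false (fun k => hn _ (α.toSetoid.trans' k hxy)) id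
      · exact iff_of_false id (fun k => hn _ (α.toSetoid.trans' k (α.toSetoid.symm' hxy)))
      · exact Iff.rfl
    · rintro (x | x) (y | y) - <;> exact Iff.rfl
  exact (hs _ _ hb).1 (α.toSetoid.refl' _)

/-- Multiplying on the right coarsens the kernel and shrinks the domain, so the kernel classes of
`α` in its domain cover those of the product. -/
theorem rank_mul_le_left (α β : PartitionMonoid n) : (α * β).rank ≤ α.rank := by
  rw [rank_eq_ncard_image_dom, rank_eq_ncard_image_dom α]
  let g : Quotient α.ker → Quotient (α * β).ker := Quotient.lift (Quotient.mk _)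
    fun a b h => Quotient.sound (ker_le_ker_mul α β h)
  refine le_trans (Set.ncard_le_ncard ?_ (Set.toFinite _))
    (Set.ncard_image_le (f := g) (Set.toFinite _))
  rintro _ ⟨a, ha, rfl⟩
  exact ⟨_, ⟨a, dom_mul_subset α β ha, rfl⟩, rfl⟩

theorem rank_mul_le_right (α β : PartitionMonoid n) : (α * β).rank ≤ β.rank := by
  rw [← rank_star (α * β), ← rank_star β, star_mul]
  exact rank_mul_le_left _ _

theorem rank_le (α : PartitionMonoid n) : α.rank ≤ n := by
  rw [rank_eq_ncard_image_dom]
  refine (Set.ncard_image_le (Set.toFinite _)).trans ?_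
  simpa using Set.ncard_le_ncard (Set.subset_univ α.dom) (Set.toFinite _)

theorem rank_ofPerm (σ : Equiv.Perm (Fin n)) : (ofPerm σ).rank = n := by
  change (ofMaps σ id).rank = n
  rw [rank_ofMaps]
  simp

theorem rank_ofPerm_mul (σ : Equiv.Perm (Fin n)) (α : PartitionMonoid n) :
    (ofPerm σ * α).rank = α.rank := by
  apply le_antisymm (rank_mul_le_right _ _)
  have : α = ofPerm σ⁻¹ * (ofPerm σ * α) := by
    rw [← mul_assoc, ofPerm_mul, mul_inv_cancel, ofPerm_one, one_mul]
  conv_lhs => rw [this]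
  exact rank_mul_le_right _ _

/-! ### Transversals, and the shape of partitions of rank `n` and `n - 1` -/

/-- A transversal of the transverse blocks, together with a permutation that maps each of its
points to a lower point of the same block. -/
theorem exists_transversal (α : PartitionMonoid n) :
    ∃ (T : Set (Fin n)) (σ : Equiv.Perm (Fin n)), T.ncard = α.rank ∧
      (∀ a ∈ T, α.toSetoid (.inl a) (.inr (σ a))) ∧
      (∀ a ∈ T, ∀ b ∈ T, α.ker a b → a = b) ∧ ∀ a ∈ α.dom, ∃ b ∈ T, α.ker a b := by
  classical
  let u : Fin n → Quotient α.toSetoid := fun i => Quotient.mk α.toSetoid (Sum.inl i)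
  let v : Fin n → Quotient α.toSetoid := fun i => Quotient.mk α.toSetoid (Sum.inr i)
  let τ : Set (Quotient α.toSetoid) := Set.range u ∩ Set.range v
  choose f hf using fun q : τ => q.2.1
  choose g hg using fun q : τ => q.2.2
  have hfi : Function.Injective f := fun a b h => Subtype.ext (by rw [← hf, ← hf, h])
  have hgi : Function.Injective g := fun a b h => Subtype.ext (by rw [← hg, ← hg, h])
  -- Matches the chosen upper and lower points of each transverse block; by finiteness this partial
  -- bijection extends to a permutation.
  let e : {x // x ∈ Set.range f} ≃ {x // x ∈ Set.range g} :=
    (Equiv.ofInjective f hfi).symm.trans (Equiv.ofInjective g hgi)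
  refine ⟨Set.range f, e.extendSubtype, ?_, ?_, ?_, ?_⟩
  · conv_rhs => rw [eq_ofMaps_quotient α, rank_ofMaps]
    rw [← Set.image_univ, Set.ncard_image_of_injective _ hfi, Set.ncard_univ]
    rfl
  · rintro _ ⟨q, rfl⟩
    rw [e.extendSubtype_apply_of_mem _ ⟨q, rfl⟩]
    have : (e ⟨f q, ⟨q, rfl⟩⟩ : Fin n) = g q := by
      have : (⟨f q, ⟨q, rfl⟩⟩ : {x // x ∈ Set.range f}) = Equiv.ofInjective f hfi q := rfl
      rw [Equiv.trans_apply, this, Equiv.symm_apply_apply]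
      rfl
    rw [this]
    exact Quotient.exact ((hf q).trans (hg q).symm)
  · rintro _ ⟨q, rfl⟩ _ ⟨r, rfl⟩ h
    have : u (f q) = u (f r) := Quotient.sound h
    rw [hf, hf] at this
    rw [Subtype.ext this]
  · intro a ha
    obtain ⟨b, hb⟩ := (mem_dom _ _).1 ha
    have hq : u a ∈ τ := ⟨⟨a, rfl⟩, b, Quotient.sound (α.toSetoid.symm' hb)⟩
    refine ⟨f ⟨_, hq⟩, ⟨_, rfl⟩, ?_⟩
    have h : u a = u (f ⟨_, hq⟩) := (hf ⟨_, hq⟩).symm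
    have h := Quotient.exact h
    exact h

/-- Kernel, cokernel and one edge from `a` to `(σ a)'` per transverse block generate the whole
equivalence. -/
theorem saturated_iff_of_transversal {α : PartitionMonoid n} {T : Set (Fin n)}
    {σ : Equiv.Perm (Fin n)} (h1 : ∀ a ∈ T, α.toSetoid (.inl a) (.inr (σ a)))
    (h2 : ∀ a ∈ α.dom, ∃ b ∈ T, α.ker a b) (P Q : Fin n → Prop) :
    α.Saturated P Q ↔ (∀ a b, α.ker a b → (P a ↔ P b)) ∧
      (∀ a b, α.coker a b → (Q a ↔ Q b)) ∧ ∀ a ∈ T, (P a ↔ Q (σ a)) := by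
  constructor
  · intro h
    exact ⟨fun a b => h (.inl a) (.inl b), fun a b => h (.inr a) (.inr b),
      fun a ha => h _ _ (h1 a ha)⟩
  · rintro ⟨hk, hc, ht⟩
    have key : ∀ a b, α.toSetoid (.inl a) (.inr b) → (P a ↔ Q b) := by
      intro a b h
      obtain ⟨c, hcT, hac⟩ := h2 a ((mem_dom _ _).2 ⟨b, h⟩)
      refine (hk a c hac).trans ((ht c hcT).trans (hc _ _ ?_))
      exact α.toSetoid.trans' (α.toSetoid.symm' (h1 c hcT))
        (α.toSetoid.trans' (α.toSetoid.symm' hac) h)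
    rintro (x | x) (y | y) hxy
    · exact hk _ _ hxy
    · exact key _ _ hxy
    · exact (key _ _ (α.toSetoid.symm' hxy)).symm
    · exact hc _ _ hxy

theorem rank_eq_iff {α : PartitionMonoid n} : α.rank = n ↔ α ∈ symmetricGroup n := by
  constructor
  · intro h
    obtain ⟨T, σ, hT, h1, h2, h3⟩ := exists_transversal α
    have hT : T = Set.univ := (Set.eq_univ_iff_ncard T).2 (by simp [hT, h])
    subst hT
    refine ⟨σ, ext_saturated fun P Q => ?_⟩
    rw [saturated_iff_of_transversal h1 h3, saturated_ofPerm]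
    constructor
    · intro h
      refine ⟨fun a b hab => by rw [h2 a trivial b trivial hab], fun a b hab => ?_,
        fun a _ => h a⟩
      have : σ⁻¹ a = σ⁻¹ b := by
        refine h2 _ trivial _ trivial ?_
        refine α.toSetoid.trans' (h1 _ trivial) (α.toSetoid.symm' ?_)
        refine α.toSetoid.trans' (h1 _ trivial) (α.toSetoid.symm' ?_)
        simpa using (coker_rel α a b).1 hab
      rw [σ⁻¹.injective this]
    · rintro ⟨-, -, h⟩ a
      exact h a trivial
  · rintro ⟨σ, rfl⟩
    exact rank_ofPerm σ

theorem mul_mem_symmetricGroup {α β : PartitionMonoid n} (h : α * β ∈ symmetricGroup n) :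
    α ∈ symmetricGroup n ∧ β ∈ symmetricGroup n := by
  rw [← rank_eq_iff] at h ⊢
  rw [← rank_eq_iff]
  have h1 := rank_mul_le_left α β
  have h2 := rank_mul_le_right α β
  have h3 := rank_le α
  have h4 := rank_le β
  omega

/-- The shape of a partition of rank `n - 1`. -/
theorem exists_normal_form (hn : 1 ≤ n) {α : PartitionMonoid n} (h : α.rank = n - 1) :
    (α.ker = ⊥ ∨ α.dom = Set.univ) ∧ (α.coker = ⊥ ∨ α.codom = Set.univ) ∧
    ∃ (i : Fin n) (σ : Equiv.Perm (Fin n)) (L R : (Fin n → Prop) → Prop),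
      (∀ P Q, α.Saturated P Q ↔ L P ∧ R (fun a => Q (σ a)) ∧ ∀ a ≠ i, (P a ↔ Q (σ a))) ∧
      (α.ker = ⊥ → ∀ P, L P) ∧ (α.dom = Set.univ → ∃ j ≠ i, ∀ P, L P ↔ (P i ↔ P j)) ∧
      (α.coker = ⊥ → ∀ P, R P) ∧
      (α.codom = Set.univ → ∃ j ≠ i, ∀ P, R P ↔ (P i ↔ P j)) := by
  -- The transversal misses exactly one point `i`. Lower points are described through `σ`, so that
  -- `σ i` plays the role of `i` there; `L` and `R` are the kernel and cokernel constraints.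
  obtain ⟨T, σ, hT, h1, h2, h3⟩ := exists_transversal α
  have hc : Tᶜ.ncard = 1 := by
    have := Set.ncard_add_ncard_compl T
    simp only [Nat.card_eq_fintype_card, Fintype.card_fin] at this
    omega
  obtain ⟨i, hi⟩ := Set.ncard_eq_one.1 hc
  have hT' : ∀ a, a ∈ T ↔ a ≠ i := fun a => by
    have : a ∈ Tᶜ ↔ a = i := by rw [hi]; rfl
    rw [Ne, ← this, Set.mem_compl_iff, not_not]
  have c2 : ∀ a ∈ T, ∀ b ∈ T, α.coker (σ a) (σ b) → a = b := fun a ha b hb hab =>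
    h2 a ha b hb (α.toSetoid.trans' (h1 a ha)
      (α.toSetoid.trans' hab (α.toSetoid.symm' (h1 b hb))))
  have c3 : ∀ a, σ a ∈ α.codom → ∃ b ∈ T, α.coker (σ a) (σ b) := by
    intro a ha
    obtain ⟨b, hb⟩ := (mem_codom _ _).1 ha
    obtain ⟨c, hc, hbc⟩ := h3 b ((mem_dom _ _).2 ⟨_, α.toSetoid.symm' hb⟩)
    exact ⟨c, hc, α.toSetoid.trans' hb (α.toSetoid.trans' hbc (h1 c hc))⟩
  simp only [hT'] at h1 h2 h3 c2 c3
  refine ⟨?_, ?_, i, σ, fun P => ∀ a b, α.ker a b → (P a ↔ P b),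
    fun P => ∀ a b, α.coker (σ a) (σ b) → (P a ↔ P b), ?_, ?_, ?_, ?_, ?_⟩
  -- All points other than `i` are in the domain. If `i` is not, it is related to no other upper
  -- point, and the kernel is trivial.
  · by_cases hd : i ∈ α.dom
    · right
      ext a
      refine iff_of_true ?_ trivial
      by_cases ha : a = i
      · rwa [ha]
      · exact (mem_dom _ _).2 ⟨_, h1 a ha⟩
    · left
      have key : ∀ a, α.ker i a → a = i := by
        intro a ha
        by_contra hai
        exact hd ((mem_dom _ _).2 ⟨_, α.toSetoid.trans' ha (h1 a hai)⟩)
      ext a b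
      refine ⟨fun hab => ?_, fun hab => by cases hab; exact α.ker.refl' _⟩
      change a = b
      by_cases ha : a = i
      · subst ha
        exact (key b hab).symm
      by_cases hb : b = i
      · subst hb
        exact key a (α.ker.symm' hab)
      exact h2 a ha b hb hab
  · by_cases hd : σ i ∈ α.codom
    · right
      ext a
      refine iff_of_true ?_ trivial
      by_cases ha : σ⁻¹ a = i
      · rwa [← ha, show σ (σ⁻¹ a) = a by simp] at hd
      · have := α.toSetoid.symm' (h1 _ ha)
        rw [show σ (σ⁻¹ a) = a by simp] at this
        exact (mem_codom _ _).2 ⟨_, this⟩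
    · left
      have key : ∀ a, α.coker (σ i) (σ a) → a = i := by
        intro a ha
        by_contra hai
        exact hd ((mem_codom _ _).2 ⟨_, α.toSetoid.trans' ha (α.toSetoid.symm' (h1 a hai))⟩)
      ext a b
      refine ⟨fun hab => ?_, fun hab => by cases hab; exact α.coker.refl' _⟩
      change a = b
      obtain ⟨a, rfl⟩ := σ.surjective a
      obtain ⟨b, rfl⟩ := σ.surjective b
      congr 1
      by_cases ha : a = i
      · subst ha
        exact (key b hab).symm
      by_cases hb : b = i
      · subst hb
        exact key a (α.coker.symm' hab)
      exact c2 a ha b hb hab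
  · intro P Q
    rw [saturated_iff_of_transversal (T := T) (σ := σ) (by simpa only [hT'] using h1)
      (by simpa only [hT'] using h3)]
    simp only [hT']
    have : (∀ a b, α.coker (σ a) (σ b) → (Q (σ a) ↔ Q (σ b))) ↔
        ∀ a b, α.coker a b → (Q a ↔ Q b) :=
      ⟨fun h a b => by simpa using h (σ⁻¹ a) (σ⁻¹ b), fun h a b => h _ _⟩
    rw [this]
  · intro hk P a b hab
    rw [hk] at hab
    cases hab
    rfl
  · intro hd
    -- Here `j` is the representative of the class of `i`; the pair `i`, `j` is the only nontrivial
    -- kernel relation.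
    obtain ⟨j, hj, hij⟩ := h3 i (hd ▸ trivial)
    refine ⟨j, hj, fun P => ⟨fun h => h i j hij, fun h a b hab => ?_⟩⟩
    have key : ∀ b, α.ker i b → (P i ↔ P b) := by
      intro b hb
      by_cases hbi : b = i
      · rw [hbi]
      · rw [← h2 j hj b hbi (α.ker.trans' (α.ker.symm' hij) hb), h]
    by_cases ha : a = i
    · subst ha
      exact key b hab
    by_cases hb : b = i
    · subst hb
      exact (key a (α.ker.symm' hab)).symm
    rw [h2 a ha b hb hab]
  · intro hk P a b hab
    rw [hk] at hab
    rw [σ.injective (show σ a = σ b from hab)]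
  · intro hd
    obtain ⟨j, hj, hij⟩ := c3 i (hd ▸ trivial)
    refine ⟨j, hj, fun P => ⟨fun h => h i j hij, fun h a b hab => ?_⟩⟩
    have key : ∀ b, α.coker (σ i) (σ b) → (P i ↔ P b) := by
      intro b hb
      by_cases hbi : b = i
      · rw [hbi]
      · rw [← c2 j hj b hbi (α.coker.trans' (α.coker.symm' hij) hb), h]
    by_cases ha : a = i
    · subst ha
      exact key b hab
    by_cases hb : b = i
    · subst hb
      exact (key a (α.coker.symm' hab)).symm
    rw [c2 a ha b hb hab]

/-! ### Generators: projections, merging idempotents and collapses -/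

/-- The idempotent in which the points of `S` and their copies are singletons. -/
noncomputable def proj (S : Set (Fin n)) : PartitionMonoid n :=
  open Classical in
  ofMaps (fun a => (Sum.inl a : Fin n ⊕ Fin n)) (fun a => if a ∈ S then Sum.inr a else Sum.inl a)

/-- The idempotent that joins the blocks of the identity along the relation `r`. -/
def merge (r : Fin n → Fin n → Prop) : PartitionMonoid n := ofMaps (Quot.mk r) (Quot.mk r)

/-- The map that sends `i` to `j` and fixes all other points. -/
def collapse (i j : Fin n) : Fin n → Fin n := Function.update id i j

theorem collapse_self (i j : Fin n) : collapse i j i = j := by simp [collapse]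

theorem collapse_of_ne {i a : Fin n} (j : Fin n) (h : a ≠ i) : collapse i j a = a := by
  simp [collapse, h]

theorem range_collapse {i j : Fin n} (h : j ≠ i) : Set.range (collapse i j) = {i}ᶜ := by
  ext a
  constructor
  · rintro ⟨b, rfl⟩
    by_cases hb : b = i
    · rw [hb, collapse_self]; exact h
    · rw [collapse_of_ne _ hb]; exact hb
  · intro ha
    exact ⟨a, collapse_of_ne _ ha⟩

theorem collapse_eq_iff {i j : Fin n} (h : j ≠ i) (P : Fin n → Prop) :
    (∀ a b, collapse i j a = collapse i j b → (P a ↔ P b)) ↔ (P i ↔ P j) := by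
  constructor
  · intro h'
    exact h' i j (by rw [collapse_self, collapse_of_ne _ h])
  · intro h' a b hab
    by_cases ha : a = i <;> by_cases hb : b = i
    · rw [ha, hb]
    · rw [ha, collapse_self, collapse_of_ne _ hb] at hab
      rw [ha, h', hab]
    · rw [hb, collapse_self, collapse_of_ne _ ha] at hab
      rw [hb, h', hab]
    · rw [collapse_of_ne _ ha, collapse_of_ne _ hb] at hab
      rw [hab]

theorem saturated_proj (S : Set (Fin n)) (P Q : Fin n → Prop) :
    (proj S).Saturated P Q ↔ ∀ a ∉ S, (P a ↔ Q a) := by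
  rw [proj, saturated_ofMaps]
  constructor
  · intro h a ha
    exact h.2.2 a a (by simp [ha])
  · intro h
    refine ⟨?_, ?_, ?_⟩
    · intro a b e
      rw [Sum.inl.inj e]
    · intro a b e
      have : a = b := by
        split_ifs at e
        · exact Sum.inr.inj e
        · exact Sum.inl.inj e
      rw [this]
    · intro a b e
      split_ifs at e with hb
      rw [Sum.inl.inj e]
      exact h b hb

theorem saturated_proj_singleton (i : Fin n) (P Q : Fin n → Prop) :
    (proj {i}).Saturated P Q ↔ ∀ a ≠ i, (P a ↔ Q a) :=
  saturated_proj {i} P Q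

theorem saturated_merge (r : Fin n → Fin n → Prop) (P Q : Fin n → Prop) :
    (merge r).Saturated P Q ↔ P = Q ∧ ∀ a b, r a b → (P a ↔ P b) := by
  rw [merge, saturated_ofMaps]
  constructor
  · intro h
    exact ⟨funext fun a => propext (h.2.2 a a rfl), fun a b hab => h.1 a b (Quot.sound hab)⟩
  · rintro ⟨rfl, h⟩
    have key : ∀ a b, Quot.mk r a = Quot.mk r b → (P a ↔ P b) := by
      intro a b e
      have := congrArg (Quot.lift P fun a b hab => propext (h a b hab)) e
      exact iff_of_eq this
    exact ⟨key, key, key⟩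

theorem saturated_ofMaps_collapse_id {i j : Fin n} (h : j ≠ i) (P Q : Fin n → Prop) :
    (ofMaps (collapse i j) id).Saturated P Q ↔ (P i ↔ P j) ∧ ∀ a ≠ i, (P a ↔ Q a) := by
  rw [saturated_ofMaps, collapse_eq_iff h]
  constructor
  · rintro ⟨h1, -, h3⟩
    exact ⟨h1, fun a ha => h3 a a (collapse_of_ne _ ha)⟩
  · rintro ⟨h1, h2⟩
    refine ⟨h1, ?_, ?_⟩
    · rintro a b rfl
      rfl
    · rintro a b rfl
      by_cases ha : a = i
      · rw [ha, collapse_self, h1]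
        exact h2 j h
      · rw [collapse_of_ne _ ha]
        exact h2 a ha

theorem saturated_ofMaps_id_collapse {i j : Fin n} (h : j ≠ i) (P Q : Fin n → Prop) :
    (ofMaps id (collapse i j)).Saturated P Q ↔ (Q i ↔ Q j) ∧ ∀ a ≠ i, (P a ↔ Q a) := by
  rw [← star_ofMaps, saturated_star, saturated_ofMaps_collapse_id h]
  exact and_congr_right fun _ => forall₂_congr fun _ _ => iff_comm

theorem saturated_ofMaps_collapse {i j k : Fin n} (hj : j ≠ i) (hk : k ≠ i)
    (P Q : Fin n → Prop) :
    (ofMaps (collapse i j) (collapse i k)).Saturated P Q ↔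
      (P i ↔ P j) ∧ (Q i ↔ Q k) ∧ ∀ a ≠ i, (P a ↔ Q a) := by
  rw [saturated_ofMaps, collapse_eq_iff hj, collapse_eq_iff hk]
  refine and_congr_right fun h1 => and_congr_right fun h2 => ?_
  constructor
  · intro h a ha
    exact h a a (by rw [collapse_of_ne _ ha, collapse_of_ne _ ha])
  · intro h a b e
    by_cases ha : a = i <;> by_cases hb : b = i
    · rw [ha, hb, collapse_self, collapse_self] at e
      rw [ha, hb, h1, h2, e]
      exact h k hk
    · rw [ha, collapse_self, collapse_of_ne _ hb] at e
      rw [ha, h1, e]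
      exact h b hb
    · rw [hb, collapse_self, collapse_of_ne _ ha] at e
      rw [hb, h2, e]
      exact h k hk
    · rw [collapse_of_ne _ ha, collapse_of_ne _ hb] at e
      rw [e]
      exact h b hb

theorem exists_perm_pair {i j k l : Fin n} (h : j ≠ i) (h' : l ≠ k) :
    ∃ τ : Equiv.Perm (Fin n), τ i = k ∧ τ j = l := by
  -- The first swap sends `i` to `k`; the second sends the current image of `j` to `l` and leaves
  -- `k` alone.
  refine ⟨Equiv.swap (Equiv.swap i k j) l * Equiv.swap i k, ?_, ?_⟩
  · rw [Equiv.Perm.mul_apply, Equiv.swap_apply_left]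
    refine Equiv.swap_apply_of_ne_of_ne (fun e => h ?_) h'.symm
    apply (Equiv.swap i k).injective
    rw [Equiv.swap_apply_left, ← e]
  · rw [Equiv.Perm.mul_apply, Equiv.swap_apply_left]

theorem saturated_ofPerm_conj (α : PartitionMonoid n) (τ : Equiv.Perm (Fin n))
    (P Q : Fin n → Prop) : (ofPerm τ * α * ofPerm τ⁻¹).Saturated P Q ↔
      α.Saturated (fun a => P (τ⁻¹ a)) (fun a => Q (τ⁻¹ a)) := by
  rw [saturated_mul_ofPerm, saturated_ofPerm_mul]

/-! ### Subsemigroups containing all permutations -/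

section Generation

variable {M : Subsemigroup (PartitionMonoid n)} (hM : ∀ σ, ofPerm σ ∈ M)
include hM

theorem ofPerm_conj_mem {α : PartitionMonoid n} (h : α ∈ M) (τ : Equiv.Perm (Fin n)) :
    ofPerm τ * α * ofPerm τ⁻¹ ∈ M :=
  M.mul_mem (M.mul_mem (hM _) h) (hM _)

theorem proj_mem (h : ∀ i, proj {i} ∈ M) (S : Set (Fin n)) : proj S ∈ M := by
  induction S, Set.toFinite S using Set.Finite.induction_on with
  | empty =>
    have : proj (∅ : Set (Fin n)) = ofPerm 1 := ext_saturated fun P Q => by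
      rw [saturated_proj, saturated_ofPerm]
      simp
    rw [this]
    exact hM 1
  | @insert i S _ _ ih =>
    have : proj (insert i S) = proj {i} * proj S := ext_saturated fun P Q => by
      simp only [saturated_mul, saturated_proj, Set.mem_insert_iff, Set.mem_singleton_iff, not_or]
      constructor
      · intro h
        -- The first factor leaves the middle point `i` free, so its value is taken from `Q`.
        refine ⟨fun a => (a = i ∧ Q a) ∨ (a ≠ i ∧ P a), ?_, ?_⟩
        · intro a ha
          simp [ha]
        · intro a ha
          by_cases hi : a = i
          · simp [hi]
          · simpa [hi] using h a ⟨hi, ha⟩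
      · rintro ⟨R, h1, h2⟩ a ha
        rw [h1 a ha.1, h2 a ha.2]
    rw [this]
    exact M.mul_mem (h i) ih

theorem merge_mem (h : ∀ i j, j ≠ i → merge (fun a b => a = i ∧ b = j) ∈ M)
    (r : Fin n → Fin n → Prop) : merge r ∈ M := by
  suffices ∀ s : Set (Fin n × Fin n), merge (fun a b => (a, b) ∈ s) ∈ M from
    this {x | r x.1 x.2}
  intro s
  induction s, Set.toFinite s using Set.Finite.induction_on with
  | empty =>
    have : merge (fun a b => (a, b) ∈ (∅ : Set (Fin n × Fin n))) = ofPerm 1 :=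
      ext_saturated fun P Q => by
        rw [saturated_merge, saturated_ofPerm]
        simp [funext_iff]
    rw [this]
    exact hM 1
  | @insert x s _ _ ih =>
    obtain ⟨i, j⟩ := x
    -- A diagonal pair imposes nothing, and `h` covers only distinct points.
    by_cases hij : j = i
    · have : merge (fun a b => (a, b) ∈ insert (i, j) s) = merge (fun a b => (a, b) ∈ s) :=
        ext_saturated fun P Q => by
          simp only [saturated_merge, Set.mem_insert_iff, Prod.mk.injEq]
          refine and_congr_right fun _ => forall₂_congr fun a b => ?_
          constructor
          · exact fun h h' => h (.inr h')
          · rintro h (⟨rfl, rfl⟩ | h')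
            · rw [hij]
            · exact h h'
      rwa [this]
    · have : merge (fun a b => (a, b) ∈ insert (i, j) s) =
          merge (fun a b => a = i ∧ b = j) * merge (fun a b => (a, b) ∈ s) :=
        ext_saturated fun P Q => by
          simp only [saturated_mul, saturated_merge, Set.mem_insert_iff, Prod.mk.injEq]
          constructor
          · rintro ⟨rfl, h⟩
            exact ⟨P, ⟨rfl, fun a b hab => h a b (.inl hab)⟩, rfl,
              fun a b hab => h a b (.inr hab)⟩
          · rintro ⟨_, ⟨rfl, h⟩, rfl, h'⟩
            exact ⟨rfl, fun a b hab => hab.elim (h a b) (h' a b)⟩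
      rw [this]
      exact M.mul_mem (h i j hij) ih

theorem eq_top_of_proj_mem_of_merge_mem (h : ∀ i, proj {i} ∈ M)
    (h' : ∀ i j, j ≠ i → merge (fun a b => a = i ∧ b = j) ∈ M) : M = ⊤ := by
  refine eq_top_iff.2 fun α _ => ?_
  obtain ⟨T, σ, -, h1, -, h2⟩ := exists_transversal α
  -- The outer idempotents impose kernel and cokernel; the middle factor retains exactly the edges
  -- at the transversal `T`.
  have : α = merge α.ker * (proj Tᶜ * ofPerm σ) * merge α.coker := ext_saturated fun P Q => by
    rw [saturated_iff_of_transversal h1 h2]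
    simp only [saturated_mul _ (merge _), saturated_mul (merge _), saturated_merge,
      saturated_mul_ofPerm, saturated_proj, Set.notMem_compl_iff]
    constructor
    · rintro ⟨hk, hc, ht⟩
      exact ⟨Q, ⟨P, ⟨rfl, hk⟩, ht⟩, rfl, hc⟩
    · rintro ⟨_, ⟨_, ⟨rfl, hk⟩, ht⟩, rfl, hc⟩
      exact ⟨hk, hc, ht⟩
  rw [this]
  exact M.mul_mem (M.mul_mem (merge_mem hM h' _) (M.mul_mem (proj_mem hM h _) (hM σ)))
    (merge_mem hM h' _)

theorem proj_mem_of_proj_mem {i : Fin n} (h : proj {i} ∈ M) (j : Fin n) : proj {j} ∈ M := by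
  have : proj {j} = ofPerm (Equiv.swap j i) * proj {i} * ofPerm (Equiv.swap j i)⁻¹ :=
    ext_saturated fun P Q => by
      rw [saturated_ofPerm_conj]
      simp only [saturated_proj_singleton, Equiv.swap_inv]
      constructor
      · intro h a ha
        exact h _ fun e =>
          ha ((Equiv.swap j i).injective (e.trans (Equiv.swap_apply_right j i).symm))
      · intro h a ha
        have := h (Equiv.swap j i a) fun e =>
          ha ((Equiv.swap j i).injective (e.trans (Equiv.swap_apply_left j i).symm))
        rwa [Equiv.swap_apply_self] at this
  rw [this]
  exact ofPerm_conj_mem hM h _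

theorem ofMaps_collapse_id_mem {i j k l : Fin n} (hj : j ≠ i) (hl : l ≠ k)
    (h : ofMaps (collapse i j) id ∈ M) : ofMaps (collapse k l) id ∈ M := by
  obtain ⟨τ, rfl, rfl⟩ := exists_perm_pair hl hj
  have : ofMaps (collapse k l) id =
      ofPerm τ * ofMaps (collapse (τ k) (τ l)) id * ofPerm τ⁻¹ :=
    ext_saturated fun P Q => by
      rw [saturated_ofPerm_conj, saturated_ofMaps_collapse_id hl,
        saturated_ofMaps_collapse_id hj]
      simp only [show τ⁻¹ (τ k) = k by simp, show τ⁻¹ (τ l) = l by simp]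
      refine and_congr_right fun _ => ⟨fun h a ha => h _ fun e => ha ?_, fun h a ha => ?_⟩
      · rw [← e]; simp
      · simpa using h (τ a) fun e => ha (τ.injective e)
  rw [this]
  exact ofPerm_conj_mem hM h _

theorem merge_mem_of_merge_mem {i j k l : Fin n} (hj : j ≠ i) (hl : l ≠ k)
    (h : merge (fun a b => a = i ∧ b = j) ∈ M) : merge (fun a b => a = k ∧ b = l) ∈ M := by
  obtain ⟨τ, rfl, rfl⟩ := exists_perm_pair hl hj
  have : merge (fun a b => a = k ∧ b = l) =
      ofPerm τ * merge (fun a b => a = τ k ∧ b = τ l) * ofPerm τ⁻¹ :=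
    ext_saturated fun P Q => by
      rw [saturated_ofPerm_conj, saturated_merge, saturated_merge]
      constructor
      · rintro ⟨rfl, h⟩
        refine ⟨rfl, ?_⟩
        rintro _ _ ⟨rfl, rfl⟩
        simpa using h
      · rintro ⟨h, h'⟩
        refine ⟨funext fun a => by simpa using congrFun h (τ a), ?_⟩
        rintro _ _ ⟨rfl, rfl⟩
        simpa using h'
  rw [this]
  exact ofPerm_conj_mem hM h _

/-- Conjugation by the swap of `j` and `k`, which fixes `i`, turns the given partition into its
image under the involution. Multiplying the two restores the same merged pair on both sides. -/
theorem merge_mem_of_ofMaps_collapse_mem {i j k : Fin n} (hj : j ≠ i) (hk : k ≠ i)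
    (h : ofMaps (collapse i j) (collapse i k) ∈ M) :
    merge (fun a b => a = i ∧ b = j) ∈ M := by
  let τ := Equiv.swap j k
  have hτ : ∀ P : Fin n → Prop, (∀ a ≠ i, P (τ a)) ↔ ∀ a ≠ i, P a := by
    have hi : τ i = i := Equiv.swap_apply_of_ne_of_ne hj.symm hk.symm
    intro P
    refine ⟨fun h a ha => ?_, fun h a ha => h _ fun e => ha (τ.injective (e.trans hi.symm))⟩
    simpa [τ] using h (τ a) fun e => ha (τ.injective (e.trans hi.symm))
  have hi : τ i = i := Equiv.swap_apply_of_ne_of_ne hj.symm hk.symm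
  have hs : ofPerm τ * ofMaps (collapse i j) (collapse i k) * ofPerm τ⁻¹ =
      ofMaps (collapse i k) (collapse i j) := ext_saturated fun P Q => by
    rw [saturated_ofPerm_conj, saturated_ofMaps_collapse hj hk,
      saturated_ofMaps_collapse hk hj, show τ⁻¹ = τ from Equiv.swap_inv _ _, hi,
      show τ j = k from Equiv.swap_apply_left _ _, show τ k = j from Equiv.swap_apply_right _ _,
      hτ fun a => P a ↔ Q a]
  have : merge (fun a b => a = i ∧ b = j) =
      ofMaps (collapse i j) (collapse i k) * ofMaps (collapse i k) (collapse i j) :=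
    ext_saturated fun P Q => by
      simp only [saturated_mul, saturated_merge, saturated_ofMaps_collapse hj hk,
        saturated_ofMaps_collapse hk hj]
      constructor
      · rintro ⟨rfl, h⟩
        have h := h i j ⟨rfl, rfl⟩
        -- In the middle row `i` is glued to `k`, which dictates its value.
        refine ⟨Function.update P i (P k), ⟨h, ?_, fun a ha => ?_⟩, ?_, h, fun a ha => ?_⟩ <;>
          simp [*]
      · rintro ⟨R, ⟨h1, h2, h3⟩, -, h5, h6⟩
        have key : ∀ a ≠ i, P a ↔ Q a := fun a ha => (h3 a ha).trans (h6 a ha)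
        constructor
        · funext a
          by_cases ha : a = i
          · rw [ha, propext h1, propext h5, propext (key j hj)]
          · exact propext (key a ha)
        · rintro _ _ ⟨rfl, rfl⟩
          exact h1
  rw [this]
  exact M.mul_mem h (hs ▸ ofPerm_conj_mem hM h τ)

/-- After conjugation both collapses use the same pair. Gluing `i` to `j` in the middle row cuts `i`
off on the outside, giving a projection; the opposite order gives a merging idempotent. -/
theorem eq_top_of_collapse_mem {i j k l : Fin n} (hj : j ≠ i) (hl : l ≠ k)
    (h : ofMaps id (collapse i j) ∈ M) (h' : ofMaps (collapse k l) id ∈ M) : M = ⊤ := by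
  have h' := ofMaps_collapse_id_mem hM hl hj h'
  have h1 : proj {i} = ofMaps id (collapse i j) * ofMaps (collapse i j) id :=
    ext_saturated fun P Q => by
      simp only [saturated_mul, saturated_proj_singleton, saturated_ofMaps_id_collapse hj,
        saturated_ofMaps_collapse_id hj]
      constructor
      · intro h
        refine ⟨Function.update P i (P j), ⟨?_, fun a ha => ?_⟩, ?_, fun a ha => ?_⟩ <;>
          simp [*]
      · rintro ⟨R, ⟨-, h1⟩, -, h2⟩ a ha
        exact (h1 a ha).trans (h2 a ha)
  have h2 : merge (fun a b => a = i ∧ b = j) = ofMaps (collapse i j) id *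
      ofMaps id (collapse i j) :=
    ext_saturated fun P Q => by
      simp only [saturated_mul, saturated_merge, saturated_ofMaps_id_collapse hj,
        saturated_ofMaps_collapse_id hj]
      constructor
      · rintro ⟨rfl, h⟩
        have h := h i j ⟨rfl, rfl⟩
        exact ⟨P, ⟨h, fun a _ => Iff.rfl⟩, h, fun a _ => Iff.rfl⟩
      · rintro ⟨R, ⟨h1, h2⟩, h3, h4⟩
        have key : ∀ a ≠ i, P a ↔ Q a := fun a ha => (h2 a ha).trans (h4 a ha)
        constructor
        · funext a
          by_cases ha : a = i
          · rw [ha, propext h1, propext h3, propext (key j hj)]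
          · exact propext (key a ha)
        · rintro _ _ ⟨rfl, rfl⟩
          exact h1
  refine eq_top_of_proj_mem_of_merge_mem hM
    (proj_mem_of_proj_mem hM (h1 ▸ M.mul_mem h h')) fun a b hab => ?_
  exact merge_mem_of_merge_mem hM hj hab (h2 ▸ M.mul_mem h' h)

/-- Strips the permutation `σ` from a normal form, leaving a standard representative. -/
theorem mem_of_saturated_iff {α β : PartitionMonoid n} {σ : Equiv.Perm (Fin n)} (h : α ∈ M)
    (hs : ∀ P Q, α.Saturated P Q ↔ β.Saturated P (fun a => Q (σ a))) : β ∈ M := by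
  have : β = α * ofPerm σ⁻¹ := ext_saturated fun P Q => by
    rw [saturated_mul_ofPerm, hs]
    simp
  rw [this]
  exact M.mul_mem h (hM _)

theorem exists_proj_mem (hn : 1 ≤ n) {α : PartitionMonoid n} (h : α ∈ M) (hr : α.rank = n - 1)
    (hk : α.ker = ⊥) (hc : α.coker = ⊥) : ∃ i, proj {i} ∈ M := by
  obtain ⟨-, -, i, σ, L, R, hs, hL, -, hR, -⟩ := exists_normal_form hn hr
  refine ⟨i, mem_of_saturated_iff hM h (σ := σ) fun P Q => ?_⟩
  simp [hs, hL hk, hR hc, saturated_proj_singleton]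

theorem exists_ofMaps_id_collapse_mem (hn : 1 ≤ n) {α : PartitionMonoid n} (h : α ∈ M)
    (hr : α.rank = n - 1) (hk : α.ker = ⊥) (hc : α.codom = Set.univ) :
    ∃ i j, j ≠ i ∧ ofMaps id (collapse i j) ∈ M := by
  obtain ⟨-, -, i, σ, L, R, hs, hL, -, -, hR⟩ := exists_normal_form hn hr
  obtain ⟨j, hj, hR⟩ := hR hc
  refine ⟨i, j, hj, mem_of_saturated_iff hM h (σ := σ) fun P Q => ?_⟩
  simp [hs, hL hk, hR, saturated_ofMaps_id_collapse hj]

theorem exists_ofMaps_collapse_id_mem (hn : 1 ≤ n) {α : PartitionMonoid n} (h : α ∈ M)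
    (hr : α.rank = n - 1) (hk : α.dom = Set.univ) (hc : α.coker = ⊥) :
    ∃ i j, j ≠ i ∧ ofMaps (collapse i j) id ∈ M := by
  obtain ⟨-, -, i, σ, L, R, hs, -, hL, hR, -⟩ := exists_normal_form hn hr
  obtain ⟨j, hj, hL⟩ := hL hk
  refine ⟨i, j, hj, mem_of_saturated_iff hM h (σ := σ) fun P Q => ?_⟩
  simp [hs, hL, hR hc, saturated_ofMaps_collapse_id hj]

theorem exists_merge_mem (hn : 1 ≤ n) {α : PartitionMonoid n} (h : α ∈ M)
    (hr : α.rank = n - 1) (hk : α.dom = Set.univ) (hc : α.codom = Set.univ) :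
    ∃ i j, j ≠ i ∧ merge (fun a b => a = i ∧ b = j) ∈ M := by
  obtain ⟨-, -, i, σ, L, R, hs, -, hL, -, hR⟩ := exists_normal_form hn hr
  obtain ⟨j, hj, hL⟩ := hL hk
  obtain ⟨k, hk, hR⟩ := hR hc
  refine ⟨i, j, hj, merge_mem_of_ofMaps_collapse_mem hM hj hk
    (mem_of_saturated_iff hM h (σ := σ) fun P Q => ?_)⟩
  simp [hs, hL, hR, saturated_ofMaps_collapse hj hk]

/-- Rows of the grid record the kernel or domain condition, columns the cokernel or codomain
condition. If both rows and both columns are occupied, so are both cells of some diagonal; `key1`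
and `key2` settle the two diagonals. -/
theorem eq_top_of_mem (hn : 1 ≤ n) {α β γ δ : PartitionMonoid n} (hα : α ∈ M) (hβ : β ∈ M)
    (hγ : γ ∈ M) (hδ : δ ∈ M) (hα' : α.rank = n - 1 ∧ α.ker = ⊥)
    (hβ' : β.rank = n - 1 ∧ β.dom = Set.univ) (hγ' : γ.rank = n - 1 ∧ γ.coker = ⊥)
    (hδ' : δ.rank = n - 1 ∧ δ.codom = Set.univ) : M = ⊤ := by
  have key1 : (∃ i j, j ≠ i ∧ ofMaps id (collapse i j) ∈ M) →
      (∃ i j, j ≠ i ∧ ofMaps (collapse i j) id ∈ M) → M = ⊤ := by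
    rintro ⟨i, j, hj, h⟩ ⟨k, l, hl, h'⟩
    exact eq_top_of_collapse_mem hM hj hl h h'
  have key2 : (∃ i, proj {i} ∈ M) →
      (∃ i j, j ≠ i ∧ merge (fun a b => a = i ∧ b = j) ∈ M) → M = ⊤ := by
    rintro ⟨i, h⟩ ⟨k, l, hl, h'⟩
    exact eq_top_of_proj_mem_of_merge_mem hM (proj_mem_of_proj_mem hM h)
      fun a b hab => merge_mem_of_merge_mem hM hl hab h'
  have be := @exists_ofMaps_id_collapse_mem _ _ hM hn
  have bd := @exists_proj_mem _ _ hM hn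
  have cd := @exists_ofMaps_collapse_id_mem _ _ hM hn
  have ce := @exists_merge_mem _ _ hM hn
  obtain ⟨hα1, hα2⟩ := hα'
  obtain ⟨hβ1, hβ2⟩ := hβ'
  obtain ⟨hγ1, hγ2⟩ := hγ'
  obtain ⟨hδ1, hδ2⟩ := hδ'
  rcases (exists_normal_form hn hα1).2.1 with a | a <;>
  rcases (exists_normal_form hn hβ1).2.1 with b | b <;>
  rcases (exists_normal_form hn hγ1).1 with c | c <;>
  rcases (exists_normal_form hn hδ1).1 with d | d
  all_goals first
    | exact key2 (bd hα hα1 hα2 a) (ce hβ hβ1 hβ2 b)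
    | exact key2 (bd hα hα1 hα2 a) (ce hδ hδ1 d hδ2)
    | exact key2 (bd hγ hγ1 c hγ2) (ce hβ hβ1 hβ2 b)
    | exact key2 (bd hγ hγ1 c hγ2) (ce hδ hδ1 d hδ2)
    | exact key1 (be hα hα1 hα2 a) (cd hβ hβ1 hβ2 b)
    | exact key1 (be hα hα1 hα2 a) (cd hγ hγ1 c hγ2)
    | exact key1 (be hδ hδ1 d hδ2) (cd hβ hβ1 hβ2 b)

end Generation

end PartitionMonoid
-- A criterion for maximality
-- An antichain of proper subsemigroups above which nothing proper escapes consists of precisely the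
-- maximal ones.
theorem isMaximalSubsemigroup_iff_mem {S : Type*} [Mul S] {F : Set (Set S)}
    (h1 : ∀ X ∈ F, ∃ M : Subsemigroup S, (M : Set S) = X ∧ M ≠ ⊤)
    (h2 : ∀ M : Subsemigroup S, M ≠ ⊤ → ∃ X ∈ F, (M : Set S) ⊆ X)
    (h3 : ∀ X ∈ F, ∀ Y ∈ F, X ⊆ Y → X = Y) (X : Set S) :
    IsMaximalSubsemigroup X ↔ X ∈ F := by
  constructor
  · rintro ⟨M, rfl, hM⟩
    obtain ⟨X, hX, hMX⟩ := h2 M hM.1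
    obtain ⟨N, rfl, hN⟩ := h1 X hX
    rcases eq_or_lt_of_le (show M ≤ N from hMX) with h | h
    · rwa [h]
    · exact absurd (hM.2 N h) hN
  · intro hX
    obtain ⟨M, rfl, hM⟩ := h1 X hX
    refine ⟨M, rfl, hM, fun N hN => ?_⟩
    by_contra hN'
    obtain ⟨Y, hY, hNY⟩ := h2 N hN'
    have := h3 _ hX Y hY (Set.Subset.trans (show (M : Set S) ⊆ N from hN.le) hNY)
    exact hN.not_ge (by rw [← this] at hNY; exact hNY)

namespace PartitionMonoid

variable {n : ℕ}

/-! ### The four sets of rank `n - 1` -/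

theorem ofPerm_mul_rel (σ : Equiv.Perm (Fin n)) (α : PartitionMonoid n) (x y : Fin n ⊕ Fin n) :
    (ofPerm σ * α).toSetoid x y ↔ α.toSetoid (Sum.map σ id x) (Sum.map σ id y) := by
  rw [rel_iff_saturated, rel_iff_saturated]
  simp only [saturated_ofPerm_mul]
  constructor
  · intro h P Q hs
    have := h (fun a => P (σ a)) Q (by simpa using hs)
    cases x <;> cases y <;> exact this
  · intro h P Q hs
    have := h _ Q hs
    cases x <;> cases y <;> simpa using this

theorem ker_ofPerm_mul_eq_bot {σ : Equiv.Perm (Fin n)} {α : PartitionMonoid n} :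
    (ofPerm σ * α).ker = ⊥ ↔ α.ker = ⊥ := by
  have h : ∀ β : PartitionMonoid n, β.ker = ⊥ ↔ ∀ a b, β.ker a b → a = b := fun β =>
    eq_bot_iff
  rw [h, h]
  simp only [ker_rel, ofPerm_mul_rel, Sum.map_inl]
  exact ⟨fun H a b hab => σ⁻¹.injective (H _ _ (by simpa using hab)),
    fun H a b hab => σ.injective (H _ _ hab)⟩

theorem dom_ofPerm_mul_eq_univ {σ : Equiv.Perm (Fin n)} {α : PartitionMonoid n} :
    (ofPerm σ * α).dom = Set.univ ↔ α.dom = Set.univ := by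
  simp only [Set.eq_univ_iff_forall, mem_dom, ofPerm_mul_rel, Sum.map_inl, Sum.map_inr, id]
  exact ⟨fun H a => by simpa using H (σ⁻¹ a), fun H a => H _⟩

/-- The four sets of partitions of rank `n - 1` with trivial kernel, full domain, trivial
cokernel and full codomain. -/
def corankOne (n : ℕ) : Fin 4 → Set (PartitionMonoid n) :=
  ![{α | α.rank = n - 1 ∧ α.ker = ⊥}, {α | α.rank = n - 1 ∧ α.dom = Set.univ},
    {α | α.rank = n - 1 ∧ α.coker = ⊥}, {α | α.rank = n - 1 ∧ α.codom = Set.univ}]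

/-- If `α` is a unit, cancelling it passes everything to `β`. If not, its rank is below `n` yet at
least that of the product, hence equal to `n - 1`. -/
theorem mem_corankOne_of_mul_mem_aux {p : PartitionMonoid n → Prop}
    (h1 : ∀ α β, p (α * β) → p α) (h2 : ∀ σ α, p (ofPerm σ * α) → p α)
    (α β : PartitionMonoid n) (h : (α * β).rank = n - 1 ∧ p (α * β)) :
    (α.rank = n - 1 ∧ p α) ∨ (β.rank = n - 1 ∧ p β) := by
  by_cases hα : α ∈ symmetricGroup n
  · right
    obtain ⟨σ, rfl⟩ := hα
    exact ⟨by rw [← h.1, rank_ofPerm_mul], h2 _ _ h.2⟩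
  · left
    refine ⟨?_, h1 _ _ h.2⟩
    rw [← rank_eq_iff] at hα
    have := rank_mul_le_left α β
    have := rank_le α
    omega

theorem mem_corankOne_of_mul_mem {k : Fin 4} {α β : PartitionMonoid n}
    (h : α * β ∈ corankOne n k) : α ∈ corankOne n k ∨ β ∈ corankOne n k := by
  have hk := mem_corankOne_of_mul_mem_aux (n := n) (p := fun α => α.ker = ⊥)
    (fun α β h => eq_bot_iff.2 ((ker_le_ker_mul α β).trans h.le))
    (fun _ _ => ker_ofPerm_mul_eq_bot.1)
  have hd := mem_corankOne_of_mul_mem_aux (n := n) (p := fun α => α.dom = Set.univ)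
    (fun α β h => Set.eq_univ_of_univ_subset (h ▸ dom_mul_subset α β))
    (fun _ _ => dom_ofPerm_mul_eq_univ.1)
  fin_cases k
  · exact hk α β h
  · exact hd α β h
  -- The involution reverses products and exchanges the conditions on the two rows.
  · have := hk β.star α.star
    rw [← star_mul, rank_star, rank_star, rank_star] at this
    exact (this h).symm
  · have := hd β.star α.star
    rw [← star_mul, rank_star, rank_star, rank_star] at this
    exact (this h).symm

theorem rank_of_mem_corankOne {k : Fin 4} {α : PartitionMonoid n} (h : α ∈ corankOne n k) :
    α.rank = n - 1 := by
  fin_cases k <;> exact h.1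

theorem notMem_symmetricGroup_of_mem_corankOne (hn : 1 ≤ n) {k : Fin 4} {α : PartitionMonoid n}
    (h : α ∈ corankOne n k) : α ∉ symmetricGroup n := by
  rw [← rank_eq_iff, rank_of_mem_corankOne h]
  omega

section OfMaps

variable {Y : Type*} {u v : Fin n → Y}

theorem ker_ofMaps_eq_bot : (ofMaps u v).ker = ⊥ ↔ Function.Injective u := eq_bot_iff

theorem coker_ofMaps_eq_bot : (ofMaps u v).coker = ⊥ ↔ Function.Injective v := by
  rw [coker, star_ofMaps, ker_ofMaps_eq_bot]

theorem dom_ofMaps_eq_univ : (ofMaps u v).dom = Set.univ ↔ Set.range u ⊆ Set.range v := by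
  simp only [Set.eq_univ_iff_forall, mem_dom_ofMaps]
  exact Set.range_subset_iff.symm

theorem codom_ofMaps_eq_univ : (ofMaps u v).codom = Set.univ ↔ Set.range v ⊆ Set.range u := by
  rw [codom, star_ofMaps, dom_ofMaps_eq_univ]

end OfMaps

theorem not_injective_collapse {i j : Fin n} (h : j ≠ i) :
    ¬ Function.Injective (collapse i j) := fun hi =>
  h (hi (by rw [collapse_self, collapse_of_ne _ h]))

theorem not_univ_subset_range_collapse {i j : Fin n} (h : j ≠ i) :
    ¬ Set.univ ⊆ Set.range (collapse i j) := by
  rw [range_collapse h]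
  exact fun hs => hs (Set.mem_univ i) rfl

theorem ncard_range_collapse {i j : Fin n} (h : j ≠ i) :
    (Set.range (collapse i j)).ncard = n - 1 := by
  rw [range_collapse h]
  have := Set.ncard_add_ncard_compl {i}
  simp only [Nat.card_eq_fintype_card, Fintype.card_fin, Set.ncard_singleton] at this
  omega

theorem proj_singleton_properties (i : Fin n) :
    (proj {i}).rank = n - 1 ∧ (proj {i}).ker = ⊥ ∧ (proj {i}).coker = ⊥ ∧
      (proj {i}).dom ≠ Set.univ ∧ (proj {i}).codom ≠ Set.univ := by
  rw [proj, rank_ofMaps, ker_ofMaps_eq_bot, coker_ofMaps_eq_bot, Ne, Ne, dom_ofMaps_eq_univ,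
    codom_ofMaps_eq_univ]
  refine ⟨?_, Sum.inl_injective, ?_, ?_, ?_⟩
  · have : ∀ s : Set (Fin n ⊕ Fin n), s = Sum.inl '' {i}ᶜ → s.ncard = n - 1 := by
      rintro _ rfl
      rw [Set.ncard_image_of_injective _ Sum.inl_injective]
      have := Set.ncard_add_ncard_compl {i}
      simp only [Nat.card_eq_fintype_card, Fintype.card_fin, Set.ncard_singleton] at this
      omega
    apply this
    ext x
    constructor
    · rintro ⟨⟨a, rfl⟩, b, hb⟩
      dsimp only at hb
      split_ifs at hb with h
      exact ⟨a, by rw [← Sum.inl.inj hb]; exact h, rfl⟩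
    · rintro ⟨a, ha, rfl⟩
      exact ⟨⟨a, rfl⟩, a, if_neg ha⟩
  · intro a b e
    dsimp only at e
    split_ifs at e
    · exact Sum.inr.inj e
    · exact Sum.inl.inj e
  · intro h
    obtain ⟨b, hb⟩ := h ⟨i, rfl⟩
    dsimp only at hb
    split_ifs at hb with h'
    exact h' (Sum.inl.inj hb)
  · intro h
    obtain ⟨b, hb⟩ := h ⟨i, rfl⟩
    simp at hb

/-- One representative of each of the four grid types, each lying in exactly two of the sets,
separates any two of them. Collapses need two distinct points, whence `2 ≤ n`. -/
theorem corankOne_subset_iff (hn : 2 ≤ n) {k l : Fin 4} :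
    corankOne n k ⊆ corankOne n l ↔ k = l := by
  refine ⟨fun h => ?_, fun h => h ▸ subset_rfl⟩
  obtain ⟨i, j, hj⟩ : ∃ i j : Fin n, j ≠ i :=
    ⟨⟨0, by omega⟩, ⟨1, by omega⟩, by simp⟩
  obtain ⟨p1, p2, p3, p4, p5⟩ := proj_singleton_properties i
  have hc := not_injective_collapse hj
  have hu := not_univ_subset_range_collapse hj
  have hr := ncard_range_collapse hj
  have e1 : (ofMaps (collapse i j) (collapse i j)).rank = n - 1 := by
    rwa [rank_ofMaps, Set.inter_self]
  have f1 : (ofMaps id (collapse i j)).rank = n - 1 := by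
    rwa [rank_ofMaps, Set.range_id, Set.univ_inter]
  have g1 : (ofMaps (collapse i j) id).rank = n - 1 := by
    rwa [rank_ofMaps, Set.range_id, Set.inter_univ]
  have e2 : (ofMaps (collapse i j) (collapse i j)).ker ≠ ⊥ := mt ker_ofMaps_eq_bot.1 hc
  have e3 : (ofMaps (collapse i j) (collapse i j)).coker ≠ ⊥ := mt coker_ofMaps_eq_bot.1 hc
  have e4 : (ofMaps (collapse i j) (collapse i j)).dom = Set.univ :=
    dom_ofMaps_eq_univ.2 subset_rfl
  have e5 : (ofMaps (collapse i j) (collapse i j)).codom = Set.univ :=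
    codom_ofMaps_eq_univ.2 subset_rfl
  have f2 : (ofMaps id (collapse i j)).ker = ⊥ := ker_ofMaps_eq_bot.2 Function.injective_id
  have f3 : (ofMaps id (collapse i j)).coker ≠ ⊥ := mt coker_ofMaps_eq_bot.1 hc
  have f4 : (ofMaps id (collapse i j)).dom ≠ Set.univ :=
    mt dom_ofMaps_eq_univ.1 (by rwa [Set.range_id])
  have f5 : (ofMaps id (collapse i j)).codom = Set.univ :=
    codom_ofMaps_eq_univ.2 (by rw [Set.range_id]; exact Set.subset_univ _)
  have g2 : (ofMaps (collapse i j) id).ker ≠ ⊥ := mt ker_ofMaps_eq_bot.1 hc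
  have g3 : (ofMaps (collapse i j) id).coker = ⊥ := coker_ofMaps_eq_bot.2 Function.injective_id
  have g4 : (ofMaps (collapse i j) id).dom = Set.univ :=
    dom_ofMaps_eq_univ.2 (by rw [Set.range_id]; exact Set.subset_univ _)
  have g5 : (ofMaps (collapse i j) id).codom ≠ Set.univ :=
    mt codom_ofMaps_eq_univ.1 (by rwa [Set.range_id])
  fin_cases k <;> fin_cases l <;> first
    | rfl
    | exact absurd (h ⟨p1, p2⟩).2 p4
    | exact absurd (h ⟨p1, p2⟩).2 p5
    | exact absurd (h ⟨p1, p3⟩).2 p4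
    | exact absurd (h ⟨p1, p3⟩).2 p5
    | exact absurd (h ⟨e1, e4⟩).2 e2
    | exact absurd (h ⟨e1, e4⟩).2 e3
    | exact absurd (h ⟨e1, e5⟩).2 e2
    | exact absurd (h ⟨e1, e5⟩).2 e3
    | exact absurd (h ⟨f1, f2⟩).2 f3
    | exact absurd (h ⟨f1, f5⟩).2 f4
    | exact absurd (h ⟨g1, g3⟩).2 g2
    | exact absurd (h ⟨g1, g4⟩).2 g5

theorem corankOne_nonempty (hn : 2 ≤ n) (k : Fin 4) : (corankOne n k).Nonempty := by
  by_contra h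
  rw [Set.not_nonempty_iff_eq_empty] at h
  -- An empty member would be contained in two different members.
  have h0 := (corankOne_subset_iff hn (k := k) (l := 0)).1 (h ▸ Set.empty_subset _)
  have h1 := (corankOne_subset_iff hn (k := k) (l := 1)).1 (h ▸ Set.empty_subset _)
  exact absurd (h0.symm.trans h1) (by decide)

/-! ### The candidate family and its count -/

/-- The non-units together with the units that come from `U`. -/
def withUnits (U : Subgroup (Equiv.Perm (Fin n))) : Set (PartitionMonoid n) :=
  (Set.univ \ symmetricGroup n) ∪ ofPerm '' (U : Set (Equiv.Perm (Fin n)))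

theorem ofPerm_mem_withUnits {U : Subgroup (Equiv.Perm (Fin n))} {σ : Equiv.Perm (Fin n)} :
    ofPerm σ ∈ withUnits U ↔ σ ∈ U := by
  constructor
  · rintro (h | h)
    · exact absurd ⟨σ, rfl⟩ h.2
    · exact (ofPerm_injective.mem_set_image).1 h
  · exact fun h => .inr ⟨σ, h, rfl⟩

theorem mem_withUnits_of_notMem {U : Subgroup (Equiv.Perm (Fin n))} {α : PartitionMonoid n}
    (h : α ∉ symmetricGroup n) : α ∈ withUnits U := .inl ⟨trivial, h⟩

theorem withUnits_subset_iff {U V : Subgroup (Equiv.Perm (Fin n))} :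
    withUnits U ⊆ withUnits V ↔ U ≤ V := by
  constructor
  · intro h σ hσ
    exact ofPerm_mem_withUnits.1 (h (ofPerm_mem_withUnits.2 hσ))
  · exact fun h => Set.union_subset_union_right _ (Set.image_mono h)

theorem withUnits_injective : Function.Injective (withUnits (n := n)) := fun _ _ h =>
  le_antisymm (withUnits_subset_iff.1 h.subset) (withUnits_subset_iff.1 h.superset)

theorem not_withUnits_subset (hn : 2 ≤ n) (U : Subgroup (Equiv.Perm (Fin n))) (k : Fin 4) :
    ¬ withUnits U ⊆ Set.univ \ corankOne n k := by
  obtain ⟨α, hα⟩ := corankOne_nonempty hn k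
  exact fun h => (h (mem_withUnits_of_notMem
    (notMem_symmetricGroup_of_mem_corankOne (by omega) hα))).2 hα

theorem ofPerm_mem_diff_corankOne (hn : 1 ≤ n) (σ : Equiv.Perm (Fin n)) (k : Fin 4) :
    ofPerm σ ∈ Set.univ \ corankOne n k :=
  ⟨trivial, fun h => notMem_symmetricGroup_of_mem_corankOne hn h ⟨σ, rfl⟩⟩

/-- The union of `withUnits` over the maximal subgroups and the complements of `corankOne`. -/
def maximalFamily (n : ℕ) : Set (Set (PartitionMonoid n)) :=
  withUnits '' {U | IsCoatom U} ∪ Set.range fun k => Set.univ \ corankOne n k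

theorem exists_subsemigroup_of_mem_maximalFamily (hn : 2 ≤ n) :
    ∀ X ∈ maximalFamily n,
      ∃ M : Subsemigroup (PartitionMonoid n), (M : Set (PartitionMonoid n)) = X ∧ M ≠ ⊤ := by
  rintro _ (⟨U, hU, rfl⟩ | ⟨k, rfl⟩)
  · refine ⟨⟨withUnits U, fun {α β} hα hβ => ?_⟩, rfl, fun h => hU.1 ?_⟩
    · by_cases h : α * β ∈ symmetricGroup n
      · obtain ⟨⟨σ, rfl⟩, ⟨τ, rfl⟩⟩ := mul_mem_symmetricGroup h
        rw [ofPerm_mem_withUnits] at hα hβ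
        rw [ofPerm_mul, ofPerm_mem_withUnits]
        exact U.mul_mem hβ hα
      · exact mem_withUnits_of_notMem h
    · refine eq_top_iff.2 fun σ _ => ofPerm_mem_withUnits.1 ?_
      have : ofPerm σ ∈ (⊤ : Subsemigroup (PartitionMonoid n)) := trivial
      rwa [← h] at this
  · refine ⟨⟨Set.univ \ corankOne n k, fun {α β} hα hβ => ⟨trivial, fun h => ?_⟩⟩, rfl,
      fun h => ?_⟩
    · exact (mem_corankOne_of_mul_mem h).elim hα.2 hβ.2
    · obtain ⟨α, hα⟩ := corankOne_nonempty hn k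
      have : α ∈ (⊤ : Subsemigroup (PartitionMonoid n)) := trivial
      rw [← h] at this
      exact this.2 hα

theorem exists_coatom_of_ofPerm_notMem (hn : 2 ≤ n) {M : Subsemigroup (PartitionMonoid n)}
    (h : ¬ ∀ σ, ofPerm σ ∈ M) :
    ∃ U : Subgroup (Equiv.Perm (Fin n)), IsCoatom U ∧ ∀ σ, ofPerm σ ∈ M → σ ∈ U := by
  have : Nontrivial (Fin n) := Fin.nontrivial_iff_two_le.2 hn
  suffices ∃ H : Subgroup (Equiv.Perm (Fin n)), H ≠ ⊤ ∧ ∀ σ, ofPerm σ ∈ M → σ ∈ H by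
    obtain ⟨H, hH, hM⟩ := this
    obtain ⟨U, hU, hHU⟩ := (eq_top_or_exists_le_coatom H).resolve_left hH
    exact ⟨U, hU, fun σ hσ => hHU (hM σ hσ)⟩
  by_cases hne : ∃ σ, ofPerm σ ∈ M
  -- Only positive powers are available in a subsemigroup; finite order then supplies the identity
  -- and inverses.
  · have hpow : ∀ σ, ofPerm σ ∈ M → ∀ k : ℕ, ofPerm (σ ^ (k + 1)) ∈ M := by
      intro σ hσ k
      induction k with
      | zero => simpa using hσ
      | succ k ih =>
        rw [pow_succ, ← ofPerm_mul]
        exact M.mul_mem hσ ih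
    have hone : ofPerm 1 ∈ M := by
      obtain ⟨σ, hσ⟩ := hne
      have := hpow σ hσ (orderOf σ - 1)
      rwa [Nat.sub_add_cancel (orderOf_pos σ), pow_orderOf_eq_one] at this
    refine ⟨{ carrier := {σ | ofPerm σ ∈ M}, mul_mem' := ?_, one_mem' := hone, inv_mem' := ?_ },
      fun ht => h fun σ => ?_, fun σ hσ => hσ⟩
    · intro σ τ hσ hτ
      have := M.mul_mem hτ hσ
      rwa [ofPerm_mul] at this
    · intro σ hσ
      obtain ⟨k, hk⟩ := (mem_powers_iff_mem_zpowers (x := σ) (y := σ⁻¹)).2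
        (Subgroup.inv_mem _ (Subgroup.mem_zpowers σ))
      change σ ^ k = σ⁻¹ at hk
      change ofPerm σ⁻¹ ∈ M
      rw [← hk]
      cases k with
      | zero => simpa using hone
      | succ k => exact hpow σ hσ k
    · have : σ ∈ (⊤ : Subgroup (Equiv.Perm (Fin n))) := trivial
      rwa [← ht] at this
  -- Without permutations in `M` any proper subgroup serves; the trivial one is proper since `2 ≤
  -- n`.
  · exact ⟨⊥, bot_ne_top, fun σ hσ => absurd ⟨σ, hσ⟩ hne⟩

theorem exists_mem_maximalFamily_subset (hn : 2 ≤ n) (M : Subsemigroup (PartitionMonoid n))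
    (hM : M ≠ ⊤) : ∃ X ∈ maximalFamily n, (M : Set (PartitionMonoid n)) ⊆ X := by
  by_cases hp : ∀ σ, ofPerm σ ∈ M
  · by_contra! h
    have key : ∀ k, ∃ α ∈ M, α ∈ corankOne n k := by
      intro k
      by_contra! hk
      exact h _ (.inr ⟨k, rfl⟩) fun α hα => ⟨trivial, hk α hα⟩
    obtain ⟨α, hα, hα'⟩ := key 0
    obtain ⟨β, hβ, hβ'⟩ := key 1
    obtain ⟨γ, hγ, hγ'⟩ := key 2
    obtain ⟨δ, hδ, hδ'⟩ := key 3
    exact hM (eq_top_of_mem hp (by omega) hα hβ hγ hδ hα' hβ' hγ' hδ')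
  · obtain ⟨U, hU, hMU⟩ := exists_coatom_of_ofPerm_notMem hn hp
    refine ⟨_, .inl ⟨U, hU, rfl⟩, fun α hα => ?_⟩
    by_cases h : α ∈ symmetricGroup n
    · obtain ⟨σ, rfl⟩ := h
      exact ofPerm_mem_withUnits.2 (hMU σ hα)
    · exact mem_withUnits_of_notMem h

theorem eq_of_subset_of_mem_maximalFamily (hn : 2 ≤ n) :
    ∀ X ∈ maximalFamily n, ∀ Y ∈ maximalFamily n, X ⊆ Y → X = Y := by
  rintro _ (⟨U, hU, rfl⟩ | ⟨k, rfl⟩) _ (⟨V, hV, rfl⟩ | ⟨l, rfl⟩) h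
  · have hUV := withUnits_subset_iff.1 h
    rcases hUV.eq_or_lt with e | hlt
    · rw [e]
    · exact absurd (hU.2 V hlt) hV.1
  · exact absurd h (not_withUnits_subset hn U l)
  -- The complement of a set of rank `n - 1` contains every permutation, which would force `V` to be
  -- everything.
  · refine absurd (eq_top_iff.2 fun σ _ => ?_) hV.1
    exact ofPerm_mem_withUnits.1 (h (ofPerm_mem_diff_corankOne (by omega) σ k))
  · have hs : corankOne n l ⊆ corankOne n k := fun α hα => by
      by_contra hk
      exact (h ⟨trivial, hk⟩).2 hα
    rw [(corankOne_subset_iff hn).1 hs]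

theorem isMaximalSubsemigroup_iff_mem_maximalFamily (hn : 2 ≤ n) (X : Set (PartitionMonoid n)) :
    IsMaximalSubsemigroup X ↔ X ∈ maximalFamily n :=
  isMaximalSubsemigroup_iff_mem (exists_subsemigroup_of_mem_maximalFamily hn)
    (exists_mem_maximalFamily_subset hn) (eq_of_subset_of_mem_maximalFamily hn) X

theorem mem_maximalFamily_iff (X : Set (PartitionMonoid n)) : X ∈ maximalFamily n ↔
    (∃ U : Subgroup (Equiv.Perm (Fin n)), IsCoatom U ∧
      X = (Set.univ \ symmetricGroup n) ∪ ofPerm '' (U : Set (Equiv.Perm (Fin n)))) ∨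
    X = Set.univ \ {α : PartitionMonoid n | α.rank = n - 1 ∧ α.ker = ⊥} ∨
    X = Set.univ \ {α : PartitionMonoid n | α.rank = n - 1 ∧ α.dom = Set.univ} ∨
    X = Set.univ \ {α : PartitionMonoid n | α.rank = n - 1 ∧ α.coker = ⊥} ∨
    X = Set.univ \ {α : PartitionMonoid n | α.rank = n - 1 ∧ α.codom = Set.univ} := by
  refine or_congr (exists_congr fun U => and_congr_right fun _ => eq_comm) ⟨?_, ?_⟩
  · rintro ⟨k, rfl⟩
    fin_cases k
    · exact .inl rfl
    · exact .inr (.inl rfl)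
    · exact .inr (.inr (.inl rfl))
    · exact .inr (.inr (.inr rfl))
  · rintro (rfl | rfl | rfl | rfl)
    exacts [⟨0, rfl⟩, ⟨1, rfl⟩, ⟨2, rfl⟩, ⟨3, rfl⟩]

theorem ncard_maximalFamily (hn : 2 ≤ n) : (maximalFamily n).ncard =
    Set.ncard {U : Subgroup (Equiv.Perm (Fin n)) | IsCoatom U} + 4 := by
  rw [maximalFamily, Set.ncard_union_eq ?_ (Set.toFinite _) (Set.toFinite _),
    Set.ncard_image_of_injective _ withUnits_injective]
  · congr 1
    have hi : Function.Injective fun k : Fin 4 => Set.univ \ corankOne n k := by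
      intro k l h
      refine (corankOne_subset_iff hn).1 fun α hα => ?_
      by_contra hl
      have : α ∈ Set.univ \ corankOne n k := h.superset ⟨trivial, hl⟩
      exact this.2 hα
    rw [← Set.image_univ, Set.ncard_image_of_injective _ hi, Set.ncard_univ]
    simp
  · rw [Set.disjoint_left]
    rintro _ ⟨U, hU, rfl⟩ ⟨k, hk⟩
    exact not_withUnits_subset hn U k hk.superset

/-! ### Degree one -/

theorem saturated_proj_univ (P Q : Fin n → Prop) : (proj Set.univ).Saturated P Q :=
  (saturated_proj _ _ _).2 fun _ h => absurd trivial h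

theorem proj_univ_mul_self : (proj Set.univ : PartitionMonoid n) * proj Set.univ = proj Set.univ :=
  ext_saturated fun P Q => by simp [saturated_mul, saturated_proj_univ]

theorem eq_one_or_eq_proj_univ (α : PartitionMonoid 1) : α = 1 ∨ α = proj Set.univ := by
  by_cases h : α.toSetoid (.inl 0) (.inr 0)
  · left
    refine ext_saturated fun P Q => ?_
    rw [saturated_one]
    constructor
    · intro hs
      funext a
      rw [Subsingleton.elim a 0]
      exact propext (hs _ _ h)
    · rintro rfl (x | x) (y | y) - <;> rw [Subsingleton.elim x y] <;> exact Iff.rfl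
  · right
    refine ext_saturated fun P Q => iff_of_true ?_ (saturated_proj_univ _ _)
    rintro (x | x) (y | y) hxy
    · rw [Subsingleton.elim x y]
    · rw [Subsingleton.elim x 0, Subsingleton.elim y 0] at hxy
      exact absurd hxy h
    · rw [Subsingleton.elim x 0, Subsingleton.elim y 0] at hxy
      exact absurd (α.toSetoid.symm' hxy) h
    · rw [Subsingleton.elim x y]

theorem one_ne_proj_univ : (1 : PartitionMonoid 1) ≠ proj Set.univ := by
  intro h
  have := saturated_proj_univ (n := 1) (fun _ => True) (fun _ => False)
  rw [← h, saturated_one] at this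
  exact iff_of_eq (congrFun this 0) |>.1 trivial

theorem mul_self_of_degree_one (α : PartitionMonoid 1) : α * α = α := by
  rcases eq_one_or_eq_proj_univ α with rfl | rfl
  · exact one_mul 1
  · exact proj_univ_mul_self

theorem mul_comm_of_degree_one (α β : PartitionMonoid 1) : α * β = β * α := by
  rcases eq_one_or_eq_proj_univ α with rfl | rfl
  · rw [one_mul, mul_one]
  · rcases eq_one_or_eq_proj_univ β with rfl | rfl
    · rw [one_mul, mul_one]
    · rfl

theorem card_of_degree_one : Nat.card (PartitionMonoid 1) = 2 := by
  rw [← Set.ncard_univ, ← Set.ncard_pair one_ne_proj_univ]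
  congr 1
  ext α
  simpa using eq_one_or_eq_proj_univ α

theorem exists_ne_of_degree_one (α : PartitionMonoid 1) : ∃ β, β ≠ α ∧ ∀ γ, γ = α ∨ γ = β := by
  rcases eq_one_or_eq_proj_univ α with rfl | rfl
  · exact ⟨_, one_ne_proj_univ.symm, eq_one_or_eq_proj_univ⟩
  · exact ⟨_, one_ne_proj_univ, fun γ => (eq_one_or_eq_proj_univ γ).symm⟩

/-- Singletons are subsemigroups by idempotency. A proper subsemigroup, possibly empty, omits one of
the two elements and so lies in the singleton of the other. -/
theorem isMaximalSubsemigroup_iff_of_degree_one (X : Set (PartitionMonoid 1)) :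
    IsMaximalSubsemigroup X ↔ ∃ α : PartitionMonoid 1, X = {α} := by
  refine isMaximalSubsemigroup_iff_mem (F := {X | ∃ α : PartitionMonoid 1, X = {α}}) ?_ ?_ ?_ X
  · rintro _ ⟨α, rfl⟩
    refine ⟨⟨{α}, ?_⟩, rfl, fun h => ?_⟩
    · rintro _ _ rfl rfl
      exact mul_self_of_degree_one _
    · obtain ⟨β, hβ, -⟩ := exists_ne_of_degree_one α
      have : β ∈ (⊤ : Subsemigroup (PartitionMonoid 1)) := trivial
      rw [← h] at this
      exact hβ this
  · intro M hM
    obtain ⟨α, hα⟩ : ∃ α, α ∉ M := by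
      by_contra! h
      exact hM (eq_top_iff.2 fun α _ => h α)
    obtain ⟨β, -, hβ⟩ := exists_ne_of_degree_one α
    exact ⟨{β}, ⟨β, rfl⟩, fun γ hγ => (hβ γ).resolve_left fun e => hα (e ▸ hγ)⟩
  · rintro _ ⟨α, rfl⟩ _ ⟨β, rfl⟩ h
    rw [Set.singleton_subset_singleton.1 h]

end PartitionMonoid

theorem mainTheorem1 :
    (∀ n : ℕ, 2 ≤ n →
      (∀ X : Set (PartitionMonoid n), IsMaximalSubsemigroup X ↔
        (∃ U : Subgroup (Equiv.Perm (Fin n)), IsCoatom U ∧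
          X = (Set.univ \ PartitionMonoid.symmetricGroup n) ∪
            PartitionMonoid.ofPerm '' (U : Set (Equiv.Perm (Fin n)))) ∨
        X = Set.univ \ {α : PartitionMonoid n | α.rank = n - 1 ∧ α.ker = ⊥} ∨
        X = Set.univ \ {α : PartitionMonoid n | α.rank = n - 1 ∧ α.dom = Set.univ} ∨
        X = Set.univ \ {α : PartitionMonoid n | α.rank = n - 1 ∧ α.coker = ⊥} ∨
        X = Set.univ \ {α : PartitionMonoid n | α.rank = n - 1 ∧ α.codom = Set.univ}) ∧
      Set.ncard {X : Set (PartitionMonoid n) | IsMaximalSubsemigroup X} =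
        Set.ncard {U : Subgroup (Equiv.Perm (Fin n)) | IsCoatom U} + 4) ∧
    ((∀ α β : PartitionMonoid 1, α * β = β * α) ∧
      (∀ α : PartitionMonoid 1, α * α = α) ∧
      Nat.card (PartitionMonoid 1) = 2 ∧
      ∀ X : Set (PartitionMonoid 1),
        IsMaximalSubsemigroup X ↔ ∃ α : PartitionMonoid 1, X = {α}) := by
  refine ⟨fun n hn => ⟨fun X => ?_, ?_⟩, PartitionMonoid.mul_comm_of_degree_one,
    PartitionMonoid.mul_self_of_degree_one, PartitionMonoid.card_of_degree_one,
    PartitionMonoid.isMaximalSubsemigroup_iff_of_degree_one⟩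
  · rw [PartitionMonoid.isMaximalSubsemigroup_iff_mem_maximalFamily hn,
      PartitionMonoid.mem_maximalFamily_iff]
  · rw [← PartitionMonoid.ncard_maximalFamily hn]
    congr 1
    ext X
    exact PartitionMonoid.isMaximalSubsemigroup_iff_mem_maximalFamily hn X
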